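/- Let $k$ be an arbitrary field. A *variety* over a field $F$ is an integral, separated scheme of finite type over $F$ (not necessarily geometrically integral, normal or proper). For a birational map $\phi\colon X\dashrightarrow Y$ of varieties, let $\mathrm{ExDiv}(\phi)$ be the (finite) set of integral closed subvarieties $D\subset X$ of codimension $1$ such that $\phi$ is not a local isomorphism at the generic point of $D$, i.e. no open neighbourhood of that point is mapped by $\phi$ isomorphically onto an open subset of $Y$. Let $\mathrm{Burn}(k)$ be the free abelian group on birational equivalence classes $[X]$ of $k$-varieties. Let $\mathcal{B}urn(k)$ be the free abelian group on the classes $[X/F]$, where $F/k$ is a finitely generated field extension and $X$ is a variety over $F$; here $[X/F]=[X'/F']$ if there are a $k$-isomorphism $F\cong F'$ and a birational map $X\dashrightarrow X'$ compatible with it. The forgetful homomorphism $\mathcal{B}urn(k)\to\mathrm{Burn}(k)$ sends $[X/F]$ to the class of a $k$-variety with function field $F(X)$ (as an extension of $k$). For a birational map $\phi\colon X_1/F_1\dashrightarrow X_2/F_2$ compatible with a $k$-isomorphism $F_1\cong F_2$ put $$c(\phi)=\sum_{E\in \mathrm{ExDiv}(\phi^{-1})}[E/F_2]-\sum_{D\in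 \mathrm{ExDiv}(\phi)}[D/F_1]\in\mathcal{B}urn(k),$$ and for a $k$-birational map $\phi\colon X_1\dashrightarrow X_2$ of $k$-varieties define $c(\phi)=\sum_{E\in \mathrm{ExDiv}(\phi^{-1})}[E]-\sum_{D\in \mathrm{ExDiv}(\phi)}[D]\in\mathrm{Burn}(k)$. Let $\pi\colon X\dashrightarrow B$ be a dominant rational map of $k$-varieties, let $U\subset X$ be the complement of its indeterminacy locus, and let $U_{k(B)}$ be the generic fibre of $\pi|_U\colon U\to B$, a variety over the function field $k(B)$. Let $\mathrm{Bir}(\pi)$ be the group of $k$-birational automorphisms $\phi$ of $X$ for which there is a $k$-birational automorphism $\sigma$ of $B$ with $\pi\circ\phi=\sigma\circ\pi$. Such a $\phi$ induces a birational automorphism $\phi^\eta$ of $U_{k(B)}$, compatible with the automorphism of $k(B)$ given by $\sigma$. Let $c_{\mathrm{hor}}(\phi)\in\mathrm{Burn}(k)$ be the image of $c(\phi^\eta)$ under the forgetful homomorphism, and $$c_{\mathrm{ver}}(\phi)=c(\phi)-c_{\mathrm{hor}}(\phi)\in\mathrm{Burn}(k).$$ Let $\mathrm{Bir}(X/B)\le\mathrm{Bir}(\pi)$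 be the subgroup of those $\phi$ with $\sigma=\mathrm{id}_B$. **Statement.** For every dominant rational map $\pi\colon X\dashrightarrow B$ of varieties over a field $k$ and every $\phi\in\mathrm{Bir}(X/B)$, $$c_{\mathrm{ver}}(\phi)=0 .$$ -/

import Mathlib

universe u

namespace MotivicInv

open CategoryTheory AlgebraicGeometry AlgebraicGeometry.Scheme Limits TopologicalSpace

/-- `s : X ⟶ Spec k` makes `X` a `k`-variety: integral, separated and of finite type over `k`. -/
class IsVariety (k : Type u) [Field k] (X : Scheme.{u}) (s : X ⟶ Spec (.of k)) : Prop where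
  isIntegral : IsIntegral X
  isSeparated : IsSeparated s
  locallyOfFiniteType : LocallyOfFiniteType s
  quasiCompact : QuasiCompact s

/-- A variety over the field `k`. -/
structure Variety (k : Type u) [Field k] : Type (u + 1) where
  X : Scheme.{u}
  str : X ⟶ Spec (.of k)
  isVariety : IsVariety k X str

namespace Variety
variable {k : Type u} [Field k] (V : Variety k)

instance : IsVariety k V.X V.str := V.isVariety
instance : IsIntegral V.X := V.isVariety.isIntegral
instance : IsSeparated V.str := V.isVariety.isSeparated
instance : LocallyOfFiniteType V.str := V.isVariety.locallyOfFiniteType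
instance : QuasiCompact V.str := V.isVariety.quasiCompact

instance : IsNoetherian V.X :=
  have := LocallyOfFiniteType.isLocallyNoetherian V.str
  have : CompactSpace V.X := (quasiCompact_iff_compactSpace V.str).mp inferInstance
  {}

instance : V.X.IsSeparated where
  isSeparated_terminal_from := by
    rw [Subsingleton.elim (terminal.from V.X) (V.str ≫ terminal.from _)]
    infer_instance

end Variety

section subvariety
variable {k : Type u} [Field k]

/-- The closure of a point with its reduced induced scheme structure is integral. -/
theorem isIntegral_closure (X : Scheme.{u}) (x : X) :
    IsIntegral (IdealSheafData.vanishingIdeal (X := X) (.closure {x})).subscheme := by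
  set I := IdealSheafData.vanishingIdeal (X := X) (.closure {x}) with hI
  have hs : (I.support : Set X) = closure {x} := by
    simp [hI]
  have hred : IsReduced I.subscheme := by
    refine (IsReduced.iff_of_openCover _ I.subschemeCover.openCover).mpr fun U => ?_
    have : _root_.IsReduced (Γ(X, U.1) ⧸ I.ideal U) := by
      rw [← Ideal.isRadical_iff_quotient_reduced]
      simp only [hI]
      exact PrimeSpectrum.isRadical_vanishingIdeal _
    exact inferInstanceAs (IsReduced (Spec (.of (Γ(X, U.1) ⧸ I.ideal U))))
  have hirr : IrreducibleSpace I.subscheme := by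
    have h1 : IsIrreducible (Set.range I.subschemeι) := by
      rw [IdealSheafData.range_subschemeι, hs]
      exact isIrreducible_singleton.closure
    have : IrreducibleSpace (Set.range I.subschemeι) :=
      Subtype.irreducibleSpace h1
    exact I.subschemeι.isEmbedding.toHomeomorph.irreducibleSpace_iff.mpr this
  exact isIntegral_of_irreducibleSpace_of_isReduced _

/-- The integral closed subvariety of `V` with generic point `x`: the closure of `x` with its
reduced induced structure. -/
noncomputable def Variety.closurePt (V : Variety k) (x : V.X) : Variety k where
  X := (IdealSheafData.vanishingIdeal (X := V.X) (.closure {x})).subscheme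
  str := (IdealSheafData.vanishingIdeal (X := V.X) (.closure {x})).subschemeι ≫ V.str
  isVariety := ⟨isIntegral_closure V.X x, inferInstance, inferInstance, inferInstance⟩

end subvariety

theorem PartialIso_isOver_comp {S T X Y : Scheme.{u}} {sX : X ⟶ S} {sY : Y ⟶ S} (h : S ⟶ T)
   {f : X.PartialIso Y} (hf : f.IsOver sX sY) : f.IsOver (sX ≫ h) (sY ≫ h) := by
  have := congr($hf ≫ h)
  simpa [PartialIso.IsOver] using this

theorem birationalOver_comp {S T X Y : Scheme.{u}} {sX : X ⟶ S} {sY : Y ⟶ S} (h : S ⟶ T)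
   (hf : BirationalOver sX sY) : BirationalOver (sX ≫ h) (sY ≫ h) :=
  ⟨hf.choose, PartialIso_isOver_comp h hf.choose_spec⟩

/-- Birational equivalence of `k`-varieties. -/
instance Variety.birSetoid (k : Type u) [Field k] : Setoid (Variety k) where
  r V W := BirationalOver V.str W.str
  iseqv := ⟨fun V => .refl V.str, fun h => h.symm, fun h h' => h.trans h'⟩

/-- The Burnside group: free abelian group on birational classes of `k`-varieties. -/
abbrev Burn (k : Type u) [Field k] : Type (u + 1) :=
  FreeAbelianGroup (Quotient (Variety.birSetoid k))

/-- The class `[V]` in the Burnside group. -/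
def Variety.cls {k : Type u} [Field k] (V : Variety k) : Burn k :=
  FreeAbelianGroup.of ⟦V⟧

/-- A variety `V / F`, where `F` is a finitely generated extension field of `k`. -/
structure RelVariety (k : Type u) [Field k] : Type (u + 1) where
  F : Type u
  [field : Field F]
  [algebra : Algebra k F]
  fg : Algebra.EssFiniteType k F
  V : Variety F

attribute [instance] RelVariety.field RelVariety.algebra

namespace RelVariety
variable {k : Type u} [Field k]

/-- The isomorphism of `Spec F` and `Spec F'` induced by an isomorphism of extensions of `k`. -/
noncomputable def specMap {F F' : Type u} [Field F] [Field F'] [Algebra k F] [Algebra k F']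
   (σ : F ≃ₐ[k] F') : Spec (.of F) ⟶ Spec (.of F') :=
  Spec.map (CommRingCat.ofHom (σ.symm : F' →+* F))

theorem specMap_refl (F : Type u) [Field F] [Algebra k F] :
    specMap (AlgEquiv.refl : F ≃ₐ[k] F) = 𝟙 _ := Spec.map_id _

theorem specMap_trans {F F' F'' : Type u} [Field F] [Field F'] [Field F'']
    [Algebra k F] [Algebra k F'] [Algebra k F''] (σ : F ≃ₐ[k] F') (τ : F' ≃ₐ[k] F'') :
    specMap (σ.trans τ) = specMap σ ≫ specMap τ := by
  simp only [specMap, ← Spec.map_comp]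
  rfl

/-- Isomorphism of varieties over extensions of `k`: there are a `k`-isomorphism `σ` of the base
fields and a birational map compatible with `σ`. -/
instance setoid (k : Type u) [Field k] : Setoid (RelVariety k) where
  r R R' := ∃ σ : R.F ≃ₐ[k] R'.F, BirationalOver (R.V.str ≫ specMap σ) R'.V.str
  iseqv := by
    refine ⟨fun R => ⟨.refl, ?_⟩, ?_, ?_⟩
    · rw [specMap_refl, Category.comp_id]; exact .refl _
    · rintro R R' ⟨σ, h⟩
      refine ⟨σ.symm, ?_⟩
      have := birationalOver_comp (specMap σ.symm) h.symm
      rwa [Category.assoc, ← specMap_trans, AlgEquiv.self_trans_symm, specMap_refl,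
        Category.comp_id] at this
    · rintro R R' R'' ⟨σ, h⟩ ⟨τ, h'⟩
      refine ⟨σ.trans τ, ?_⟩
      rw [specMap_trans, ← Category.assoc]
      exact (birationalOver_comp (specMap τ) h).trans h'

end RelVariety
section birational
variable {X Y Z T : Scheme.{u}}

theorem generic_mem [IrreducibleSpace X] (f : X.PartialMap Y) : genericPoint X ∈ f.domain :=
  (genericPoint_specializes _).mem_open f.domain.2 f.dense_domain.nonempty.choose_spec

theorem comp_data_aux [PreirreducibleSpace X] [Nonempty Y]
    (f : X.PartialMap Y) [IsDominant f.hom] (g : Y.PartialMap Z) :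
    ∃ (hU : (f.domain.ι ''ᵁ f.hom ⁻¹ᵁ g.domain).toScheme ⟶ f.domain.toScheme)
      (hV : (f.domain.ι ''ᵁ f.hom ⁻¹ᵁ g.domain).toScheme ⟶ g.domain.toScheme),
      hU ≫ f.domain.ι = (f.domain.ι ''ᵁ f.hom ⁻¹ᵁ g.domain).ι ∧ hU ≫ f.hom = hV ≫ g.domain.ι ∧
      hV ≫ g.hom = (f.comp g).hom := by
  refine ⟨(f.domain.ι.isoImage (f.hom ⁻¹ᵁ g.domain)).inv ≫ (f.hom ⁻¹ᵁ g.domain).ι,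
    (f.domain.ι.isoImage (f.hom ⁻¹ᵁ g.domain)).inv ≫ f.hom ∣_ g.domain, ?_, ?_, ?_⟩
  · rw [Category.assoc, Hom.isoImage_inv_ι]
  · rw [Category.assoc, Category.assoc, morphismRestrict_ι]
  · rw [Category.assoc, PartialMap.comp_hom]

theorem comp_data [PreirreducibleSpace X] [Nonempty Y]
    (f : X.PartialMap Y) [IsDominant f.hom] (g : Y.PartialMap Z) :
    ∃ (hU : (f.comp g).domain.toScheme ⟶ f.domain.toScheme)
      (hV : (f.comp g).domain.toScheme ⟶ g.domain.toScheme),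
      hU ≫ f.domain.ι = (f.comp g).domain.ι ∧ hU ≫ f.hom = hV ≫ g.domain.ι ∧
      hV ≫ g.hom = (f.comp g).hom := comp_data_aux f g

theorem comp_lift [PreirreducibleSpace X] [Nonempty Y]
    (f : X.PartialMap Y) [IsDominant f.hom] (g : Y.PartialMap Z) (t' : T ⟶ f.domain.toScheme)
    (h : ∀ x, f.hom (t' x) ∈ g.domain) :
    ∃ t : T ⟶ (f.comp g).domain.toScheme, t ≫ (f.comp g).domain.ι = t' ≫ f.domain.ι := by
  refine ⟨IsOpenImmersion.lift (f.comp g).domain.ι (t' ≫ f.domain.ι) ?_,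
    IsOpenImmersion.lift_fac _ _ _⟩
  rintro _ ⟨x, rfl⟩
  rw [Opens.range_ι]
  exact ⟨t' x, h x, rfl⟩

/-- The germ of a composition of partial maps at the generic point. -/
theorem fromFunctionField_comp [IrreducibleSpace X] [IrreducibleSpace Y]
    (f : X.PartialMap Y) [IsDominant f.hom] (g : Y.PartialMap Z)
    (b : Spec X.functionField ⟶ Spec Y.functionField)
    (hb : f.fromFunctionField = b ≫ Y.fromSpecStalk (genericPoint Y)) :
    (f.comp g).fromFunctionField = b ≫ g.fromFunctionField := by
  obtain ⟨hU, hV, h1, h2, h3⟩ := comp_data f g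
  change (f.comp g).domain.fromSpecStalkOfMem _ (generic_mem _) ≫ (f.comp g).hom =
    b ≫ g.domain.fromSpecStalkOfMem _ (generic_mem _) ≫ g.hom
  have e1 : (f.comp g).domain.fromSpecStalkOfMem _ (generic_mem _) ≫ hU =
      f.domain.fromSpecStalkOfMem _ (generic_mem f) := by
    rw [← cancel_mono f.domain.ι, Category.assoc, h1, Opens.fromSpecStalkOfMem_ι,
      Opens.fromSpecStalkOfMem_ι]
  have e2 : (f.comp g).domain.fromSpecStalkOfMem _ (generic_mem _) ≫ hV =
      b ≫ g.domain.fromSpecStalkOfMem _ (generic_mem _) := by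
    rw [← cancel_mono g.domain.ι, Category.assoc, ← h2, reassoc_of% e1, Category.assoc,
      Opens.fromSpecStalkOfMem_ι]
    exact hb
  rw [← h3, reassoc_of% e2]

theorem map_genericPoint [IrreducibleSpace X] [IrreducibleSpace Y] (f : X ⟶ Y) [IsDominant f] :
    f (genericPoint X) = genericPoint Y := by
  have : IsGenericPoint (f (genericPoint X)) (closure (f '' Set.univ)) :=
     (genericPoint_spec X).image f.continuous
  rw [Set.image_univ, f.denseRange.closure_range] at this
  exact this.eq (genericPoint_spec Y)

theorem isDominant_of_mem_range [IrreducibleSpace Y] (f : X ⟶ Y)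
    (h : genericPoint Y ∈ Set.range f) : IsDominant f where
  denseRange := by
    rw [DenseRange, dense_iff_closure_eq, ← Set.univ_subset_iff, ← genericPoint_closure (α := Y)]
    exact closure_mono (by simpa using h)

variable [IsIntegral X] [IsIntegral Y]

theorem isDominant_of_germ (f : X.PartialMap Y) (b : Spec X.functionField ⟶ Spec Y.functionField)
    (hb : f.fromFunctionField = b ≫ Y.fromSpecStalk (genericPoint Y)) : IsDominant f.hom := by
  apply isDominant_of_mem_range
  have x : Spec X.functionField := IsLocalRing.closedPoint X.functionField
  have h1 : f.fromFunctionField x ∈ Set.range f.hom :=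
    ⟨f.domain.fromSpecStalkOfMem _ (generic_mem f) x, by rw [← Scheme.Hom.comp_apply]; rfl⟩
  rw [hb, Scheme.Hom.comp_apply] at h1
  have : b x = IsLocalRing.closedPoint Y.functionField :=
    Subsingleton.elim (α := PrimeSpectrum Y.functionField) _ _
  rw [this] at h1
  erw [fromSpecStalk_closedPoint] at h1
  exact h1

variable {S : Scheme.{u}} (sX : X ⟶ S) (sY : Y ⟶ S) [LocallyOfFiniteType sX] [LocallyOfFiniteType sY]


/-- Two mutually inverse dominant partial maps come from a partial isomorphism. -/
theorem exists_partialIso_aux [X.IsSeparated] [Y.IsSeparated]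
    (f : X.PartialMap Y) (g : Y.PartialMap X) [IsDominant f.hom] [IsDominant g.hom]
    (hfg : (f.comp g).equiv (PartialMap.id X)) (hgf : (g.comp f).equiv (PartialMap.id Y)) :
    ∃ p : X.PartialIso Y, ∃ i : p.source.toScheme ⟶ f.domain.toScheme, i ≫ f.domain.ι = p.source.ι ∧
      i ≫ f.hom = p.iso.hom ≫ p.target.ι := by
  obtain ⟨hU, hV, h1, h2, h3⟩ := comp_data f g
  obtain ⟨kV, kU, k1, k2, k3⟩ := comp_data g f
  rw [(PartialMap.equiv_toPartialMap_iff_of_isSeparated (S := ⊤_ _)).mp hfg,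
    Category.comp_id] at h3
  rw [(PartialMap.equiv_toPartialMap_iff_of_isSeparated (S := ⊤_ _)).mp hgf,
    Category.comp_id] at k3
  obtain ⟨a, ha⟩ := comp_lift g f hV fun x => by
    rw [← Scheme.Hom.comp_apply, h3, ← h1, Scheme.Hom.comp_apply]
    exact (hU x).2
  obtain ⟨b, hb⟩ := comp_lift f g kU fun x => by
    rw [← Scheme.Hom.comp_apply, k3, ← k1, Scheme.Hom.comp_apply]
    exact (kV x).2
  have e1 : a ≫ kV = hV := by rw [← cancel_mono g.domain.ι, Category.assoc, k1, ha]
  have e2 : b ≫ hU = kU := by rw [← cancel_mono f.domain.ι, Category.assoc, h1, hb]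
  refine ⟨⟨(f.comp g).domain, (f.comp g).dense_domain, (g.comp f).domain, (g.comp f).dense_domain,
    ⟨a, b, ?_, ?_⟩⟩, hU, h1, ?_⟩
  · rw [← cancel_mono (f.comp g).domain.ι, Category.assoc, hb, ← k2, reassoc_of% e1, h3,
      Category.id_comp]
  · rw [← cancel_mono (g.comp f).domain.ι, Category.assoc, ha, ← h2, reassoc_of% e2, k3,
      Category.id_comp]
  · change hU ≫ f.hom = a ≫ (g.comp f).domain.ι
    rw [ha, h2]

variable {S : Scheme.{u}} (sX : X ⟶ S) (sY : Y ⟶ S)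

/-- An isomorphism of function fields over `S` is induced by a partial isomorphism over `S`. -/
theorem exists_partialIso [LocallyOfFiniteType sX] [LocallyOfFiniteType sY]
    [X.IsSeparated] [Y.IsSeparated] (e : Spec X.functionField ≅ Spec Y.functionField)
    (he : e.hom ≫ Y.fromSpecStalk _ ≫ sY = X.fromSpecStalk _ ≫ sX) :
    ∃ p : X.PartialIso Y, p.IsOver sX sY ∧
      p.toRationalMap.fromFunctionField = e.hom ≫ Y.fromSpecStalk _ := by
  let f : X.PartialMap Y := PartialMap.ofFromSpecStalk sX sY (e.hom ≫ Y.fromSpecStalk _)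
    (by rw [Category.assoc, he])
  let g : Y.PartialMap X := PartialMap.ofFromSpecStalk sY sX (e.inv ≫ X.fromSpecStalk _)
    (by rw [Category.assoc, ← he, e.inv_hom_id_assoc])
  have hf : f.fromFunctionField = e.hom ≫ Y.fromSpecStalk _ :=
    PartialMap.fromSpecStalkOfMem_ofFromSpecStalk _ _ _ _
  have hg : g.fromFunctionField = e.inv ≫ X.fromSpecStalk _ :=
    PartialMap.fromSpecStalkOfMem_ofFromSpecStalk _ _ _ _
  have := isDominant_of_germ f _ hf
  have := isDominant_of_germ g _ hg
  have hfg : (f.comp g).equiv (PartialMap.id X) := by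
    refine PartialMap.equiv_of_fromSpecStalkOfMem_eq _ _ (generic_mem _) (generic_mem _) ?_
    refine (fromFunctionField_comp f g _ hf).trans ?_
    rw [hg, e.hom_inv_id_assoc]
    refine Eq.trans ?_ (PartialMap.fromSpecStalkOfMem_toPartialMap _ _).symm
    simp
  have hgf : (g.comp f).equiv (PartialMap.id Y) := by
    refine PartialMap.equiv_of_fromSpecStalkOfMem_eq _ _ (generic_mem _) (generic_mem _) ?_
    refine (fromFunctionField_comp g f _ hg).trans ?_
    rw [hf, e.inv_hom_id_assoc]
    refine Eq.trans ?_ (PartialMap.fromSpecStalkOfMem_toPartialMap _ _).symm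
    simp
  obtain ⟨p, i, hi, hi'⟩ := exists_partialIso_aux f g hfg hgf
  have hfs : f.hom ≫ sY = f.domain.ι ≫ sX := PartialMap.ofFromSpecStalk_comp _ _ _ _
  refine ⟨p, ?_, ?_⟩
  · change p.iso.hom ≫ p.target.ι ≫ sY = p.source.ι ≫ sX
    rw [← reassoc_of% hi', hfs, reassoc_of% hi]
  · rw [← hf]
    change p.source.fromSpecStalkOfMem _ (generic_mem p.toPartialMap) ≫ p.iso.hom ≫ p.target.ι =
      f.domain.fromSpecStalkOfMem _ (generic_mem f) ≫ f.hom
    rw [← hi', ← Category.assoc]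
    congr 1
    rw [← cancel_mono f.domain.ι, Category.assoc, hi, Opens.fromSpecStalkOfMem_ι]
    exact Opens.fromSpecStalkOfMem_ι _ _ _

end birational

section functionField

theorem exists_fac_fromSpecStalk {R : CommRingCat.{u}} [IsLocalRing R] {Y : Scheme.{u}} (t : Spec R ⟶ Y)
    (y : Y) (h : t (IsLocalRing.closedPoint R) = y) : ∃ b, b ≫ Y.fromSpecStalk y = t := by
  subst h
  exact ⟨_, Spec_stalkClosedPointTo_fromSpecStalk t⟩

theorem exists_germ_of_isDominant {X Y : Scheme.{u}} [IsIntegral X] [IsIntegral Y]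
    (f : X.PartialMap Y) [IsDominant f.hom] :
    ∃ b : Spec X.functionField ⟶ Spec Y.functionField,
      b ≫ Y.fromSpecStalk (genericPoint Y) = f.fromFunctionField := by
  have : Nonempty f.domain.toScheme := ⟨⟨_, generic_mem f⟩⟩
  have : IsIntegral f.domain.toScheme := isIntegral_of_isOpenImmersion f.domain.ι
  apply exists_fac_fromSpecStalk
  have h0 : ∀ x : Spec (X.presheaf.stalk (genericPoint X)),
      X.fromSpecStalk (genericPoint X) x = genericPoint X := by
    intro x
    have : x = IsLocalRing.closedPoint X.functionField :=
      Subsingleton.elim (α := PrimeSpectrum X.functionField) _ _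
    rw [this]
    exact fromSpecStalk_closedPoint
  have h1 : ∀ x, f.domain.fromSpecStalkOfMem _ (generic_mem f) x = genericPoint f.domain := by
    intro x
    apply f.domain.ι.isOpenEmbedding.injective
    rw [← Scheme.Hom.comp_apply, Opens.fromSpecStalkOfMem_ι,
      genericPoint_eq_of_isOpenImmersion f.domain.ι, h0]
  have h2 : ∀ x, (f.domain.fromSpecStalkOfMem _ (generic_mem f) ≫ f.hom) x = genericPoint Y := by
    intro x
    rw [Scheme.Hom.comp_apply, h1, map_genericPoint]
  exact h2 _

instance {X Y : Scheme.{u}} (p : X.PartialIso Y) : IsDominant p.toPartialMap.hom := by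
  have := Opens.isDominant_ι p.dense_target
  exact inferInstanceAs (IsDominant (p.iso.hom ≫ p.target.ι))

/-- A partial isomorphism of integral schemes induces an isomorphism of function fields. -/
theorem exists_functionFieldIso {X Y : Scheme.{u}} [IsIntegral X] [IsIntegral Y]
    (p : X.PartialIso Y) : ∃ e : Spec X.functionField ≅ Spec Y.functionField,
      e.hom ≫ Y.fromSpecStalk (genericPoint Y) = p.toPartialMap.fromFunctionField := by
  have aux : ∀ {X Y : Scheme.{u}} [IsIntegral X] [IsIntegral Y] (p : X.PartialIso Y)
      (b : Spec X.functionField ⟶ Spec Y.functionField)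
      (b' : Spec Y.functionField ⟶ Spec X.functionField)
      (_ : b ≫ Y.fromSpecStalk (genericPoint Y) = p.toPartialMap.fromFunctionField)
      (_ : b' ≫ X.fromSpecStalk (genericPoint X) = p.symm.toPartialMap.fromFunctionField),
      b ≫ b' = 𝟙 _ := by
    intro X Y _ _ p b b' h h'
    have h1 : genericPoint X ∈ p.source := generic_mem p.toPartialMap
    have h2 : genericPoint Y ∈ p.target := generic_mem p.symm.toPartialMap
    change _ = p.source.fromSpecStalkOfMem _ h1 ≫ p.iso.hom ≫ p.target.ι at h
    change _ = p.target.fromSpecStalkOfMem _ h2 ≫ p.iso.inv ≫ p.source.ι at h'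
    have h3 : b ≫ p.target.fromSpecStalkOfMem _ h2 =
        p.source.fromSpecStalkOfMem _ h1 ≫ p.iso.hom := by
      rw [← cancel_mono p.target.ι, Category.assoc, Category.assoc, ← h,
        Opens.fromSpecStalkOfMem_ι]
    rw [← cancel_mono (X.fromSpecStalk (genericPoint X)), Category.assoc, h', reassoc_of% h3,
      p.iso.hom_inv_id_assoc, Opens.fromSpecStalkOfMem_ι, Category.id_comp]
  obtain ⟨b, hb⟩ := exists_germ_of_isDominant p.toPartialMap
  obtain ⟨b', hb'⟩ := exists_germ_of_isDominant p.symm.toPartialMap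
  exact ⟨⟨b, b', aux p b b' hb hb', aux p.symm b' b hb' hb⟩, hb⟩

theorem germ_isOver {S X Y : Scheme.{u}} [IsIntegral X] [IsIntegral Y] {sX : X ⟶ S} {sY : Y ⟶ S}
    (p : X.PartialIso Y) (hp : p.IsOver sX sY) :
    p.toPartialMap.fromFunctionField ≫ sY = X.fromSpecStalk (genericPoint X) ≫ sX := by
  have h1 : genericPoint X ∈ p.source := generic_mem p.toPartialMap
  change (p.source.fromSpecStalkOfMem _ h1 ≫ p.iso.hom ≫ p.target.ι) ≫ sY = _
  have : p.iso.hom ≫ p.target.ι ≫ sY = p.source.ι ≫ sX := hp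
  rw [Category.assoc, Category.assoc, this, ← Category.assoc, Opens.fromSpecStalkOfMem_ι]

/-- The structure homomorphism `k → 𝒪_{X,x}` of a scheme over `k`. -/
noncomputable def stalkHom {k : Type u} [Field k] {X : Scheme.{u}} (s : X ⟶ Spec (.of k)) (x : X) :
    k →+* X.presheaf.stalk x :=
  (Spec.preimage (X.fromSpecStalk x ≫ s)).hom

theorem specMap_stalkHom {k : Type u} [Field k] {X : Scheme.{u}} (s : X ⟶ Spec (.of k)) (x : X) :
    Spec.map (CommRingCat.ofHom (stalkHom s x)) = X.fromSpecStalk x ≫ s :=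
  Spec.map_preimage _

theorem essFiniteType_toStalk (R : CommRingCat.{u}) (p : PrimeSpectrum R) :
    (StructureSheaf.toStalk R p).hom.EssFiniteType := by
  have : Algebra.EssFiniteType R ((Spec.structureSheaf R).presheaf.stalk p) :=
    .of_isLocalization ((Spec.structureSheaf R).presheaf.stalk p) p.asIdeal.primeCompl
  exact this

/-- The function field of `Spec A` is the fraction field of `A`. -/
theorem exists_functionField_spec (A : CommRingCat.{u}) [IsDomain A] (K : Type u) [Field K]
    [Algebra A K] [IsFractionRing A K] :
    ∃ e : Spec (Spec A).functionField ≅ Spec (.of K),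
      e.hom ≫ Spec.map (CommRingCat.ofHom (algebraMap A K)) = (Spec A).fromSpecStalk _ := by
  let e : K ≃ₐ[A] (Spec A).functionField := IsLocalization.algEquiv (nonZeroDivisors A) _ _
  refine ⟨Scheme.Spec.mapIso e.toRingEquiv.toCommRingCatIso.op, ?_⟩
  change Spec.map (CommRingCat.ofHom e.toRingEquiv.toRingHom) ≫ _ = _
  rw [← Spec.map_comp, Spec.fromSpecStalk_eq', ← CommRingCat.ofHom_comp]
  congr 1
  ext x
  exact e.commutes x

theorem essFiniteType_stalkHom {k : Type u} [Field k] {X : Scheme.{u}} (s : X ⟶ Spec (.of k))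
    [LocallyOfFiniteType s] (x : X) : (stalkHom s x).EssFiniteType := by
  let j : CommRingCat.of k ⟶ (Spec (.of k)).presheaf.stalk (s x) :=
    (ΓSpecIso (.of k)).inv ≫ (Spec (.of k)).presheaf.germ ⊤ (s x) trivial
  have hj : j.hom.EssFiniteType := essFiniteType_toStalk (.of k) (s x)
  have h : CommRingCat.ofHom (stalkHom s x) = j ≫ s.stalkMap x := by
    apply Spec.map_injective
    rw [specMap_stalkHom, Spec.map_comp, ← Spec.fromSpecStalk_eq, SpecMap_stalkMap_fromSpecStalk]
  have h' : stalkHom s x = (s.stalkMap x).hom.comp j.hom := congr(($h).hom)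
  rw [h']
  exact RingHom.EssFiniteType.comp hj (LocallyOfFiniteType.stalkMap s x)

end functionField

namespace RelVariety
variable {k : Type u} [Field k]

/-- The structure morphism to `Spec k`. -/
noncomputable def toBase (R : RelVariety k) : R.V.X ⟶ Spec (.of k) :=
  R.V.str ≫ Spec.map (CommRingCat.ofHom (algebraMap k R.F))

/-- `V` is a `k`-variety whose function field is the function field of `R`, as extension of `k`. -/
def IsModel (V : Variety k) (R : RelVariety k) : Prop :=
  ∃ e : Spec V.X.functionField ≅ Spec R.V.X.functionField,
    e.hom ≫ R.V.X.fromSpecStalk _ ≫ R.toBase = V.X.fromSpecStalk _ ≫ V.str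

theorem IsModel.equiv {V W : Variety k} {R R' : RelVariety k} (hV : IsModel V R)
    (hW : IsModel W R') (h : R ≈ R') : V ≈ W := by
  obtain ⟨e, he⟩ := hV
  obtain ⟨e', he'⟩ := hW
  obtain ⟨σ, p, hp⟩ := h
  obtain ⟨a, ha⟩ := exists_functionFieldIso p
  have hp' := PartialIso_isOver_comp (Spec.map (CommRingCat.ofHom (algebraMap k R'.F))) hp
  have hσ : specMap σ ≫ Spec.map (CommRingCat.ofHom (algebraMap k R'.F)) =
      Spec.map (CommRingCat.ofHom (algebraMap k R.F)) := by
    rw [specMap, ← Spec.map_comp, ← CommRingCat.ofHom_comp]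
    congr 2
    exact σ.symm.toAlgHom.comp_algebraMap
  rw [Category.assoc, hσ] at hp'
  have h1 := germ_isOver p hp'
  rw [← ha] at h1
  obtain ⟨q, hq, -⟩ := exists_partialIso V.str W.str (e ≪≫ a ≪≫ e'.symm) (by
    rw [← he, ← he']
    simp only [Iso.trans_hom, Iso.symm_hom, Category.assoc, Iso.inv_hom_id_assoc] at h1 ⊢
    unfold toBase
    rw [h1])
  exact ⟨q, hq⟩

theorem essFiniteType_toBase (R : RelVariety k) (x : R.V.X) :
    (stalkHom R.toBase x).EssFiniteType := by
  have : stalkHom R.toBase x = (stalkHom R.V.str x).comp (algebraMap k R.F) := by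
    have : CommRingCat.ofHom (stalkHom R.toBase x) = CommRingCat.ofHom (algebraMap k R.F) ≫
        CommRingCat.ofHom (stalkHom R.V.str x) := by
      apply Spec.map_injective
      rw [Spec.map_comp, specMap_stalkHom, specMap_stalkHom, toBase, Category.assoc]
    exact congr(($this).hom)
  rw [this]
  refine RingHom.EssFiniteType.comp ?_ (essFiniteType_stalkHom _ _)
  exact (RingHom.essFiniteType_algebraMap).mpr R.fg

/-- Every finitely generated extension field of `k` is the function field of a `k`-variety. -/
theorem exists_variety_of_field (K : Type u) [Field K] [Algebra k K] [Algebra.EssFiniteType k K] :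
    ∃ (V : Variety k) (e : Spec V.X.functionField ≅ Spec (.of K)),
      e.hom ≫ Spec.map (CommRingCat.ofHom (algebraMap k K)) = V.X.fromSpecStalk _ ≫ V.str := by
  let A := Algebra.EssFiniteType.subalgebra k K
  have : IsFractionRing A K := by
    have h := Algebra.EssFiniteType.isLocalization k K
    have : Algebra.EssFiniteType.submonoid k K = nonZeroDivisors A := by
      ext x
      rw [mem_nonZeroDivisors_iff_ne_zero]
      change IsUnit (x : K) ↔ _
      rw [isUnit_iff_ne_zero, Ne, ZeroMemClass.coe_eq_zero]
    rwa [this] at h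
  let s : Spec (.of A) ⟶ Spec (.of k) := Spec.map (CommRingCat.ofHom (algebraMap k A))
  have : LocallyOfFiniteType s := by
    rw [HasRingHomProperty.Spec_iff (P := @LocallyOfFiniteType)]
    exact (RingHom.finiteType_algebraMap).mpr inferInstance
  let V : Variety k := ⟨Spec (.of A), s, inferInstance, inferInstance, inferInstance, inferInstance⟩
  obtain ⟨e, he⟩ := exists_functionField_spec (.of A) K
  refine ⟨V, e, ?_⟩
  change _ = (Spec (.of A)).fromSpecStalk _ ≫ s
  rw [← he, Category.assoc, ← Spec.map_comp]
  rfl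

theorem exists_isModel (R : RelVariety k) : ∃ V : Variety k, IsModel V R := by
  let _ : Algebra k R.V.X.functionField := (stalkHom R.toBase (genericPoint R.V.X)).toAlgebra
  have : Algebra.EssFiniteType k R.V.X.functionField := essFiniteType_toBase _ _
  obtain ⟨V, e, he⟩ := exists_variety_of_field (k := k) R.V.X.functionField
  refine ⟨V, e, ?_⟩
  rw [← he, ← specMap_stalkHom]

end RelVariety

section exceptional

/-- The exceptional divisors of a birational map `f : X ⤏ Y`, given by their generic points: the
points of codimension one of `X` at which `f` is not a local isomorphism. -/
def exDiv {X Y : Scheme.{u}} (f : X ⤏ Y) : Set X :=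
  {x | Order.coheight x = 1 ∧ ¬ ∃ p : X.PartialIso Y, p.toRationalMap = f ∧ x ∈ p.source}

theorem finite_codimOne (X : Scheme.{u}) [IsNoetherian X] [IrreducibleSpace X] (U : X.Opens)
    (hU : (U : Set X).Nonempty) : {x : X | Order.coheight x = 1 ∧ x ∉ U}.Finite := by
  obtain ⟨S, hS, hS', hSU⟩ := NoetherianSpace.exists_finite_set_isClosed_irreducible
    (α := X) U.2.isClosed_compl
  obtain ⟨hSirr, hSU⟩ := hSU
  have hSU : (U : Set X)ᶜ = ⋃₀ S := hSU
  have hη : genericPoint X ∈ U :=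
    (genericPoint_specializes _).mem_open U.2 hU.choose_spec
  have hgen : ∀ s : S, ∃ g : X, IsGenericPoint g s.1 := fun s =>
    QuasiSober.sober (hSirr _ s.2) (hS' _ s.2)
  choose g hg using hgen
  have := hS.to_subtype
  refine (Set.finite_range g).subset ?_
  rintro x ⟨hx, hxU⟩
  have hxU' : x ∈ (U : Set X)ᶜ := hxU
  rw [hSU] at hxU'
  obtain ⟨s, hs, hxs⟩ := hxU'
  refine ⟨⟨s, hs⟩, ?_⟩
  by_contra hne
  have hgs := hg ⟨s, hs⟩
  have h1 : x ≤ g ⟨s, hs⟩ := hgs.specializes hxs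
  have h1' : x < g ⟨s, hs⟩ := lt_of_le_not_ge h1 fun h => hne
    (Specializes.antisymm (show g ⟨s, hs⟩ ⤳ x from h1) (show x ⤳ g ⟨s, hs⟩ from h)).eq
  have hgU : g ⟨s, hs⟩ ∉ U := by
    have : g ⟨s, hs⟩ ∈ (U : Set X)ᶜ := by rw [hSU]; exact ⟨s, hs, hgs.mem⟩
    exact this
  have h2 : g ⟨s, hs⟩ < genericPoint X :=
    lt_of_le_not_ge (genericPoint_specializes _) fun h => hgU
      (Specializes.mem_open (show g ⟨s, hs⟩ ⤳ genericPoint X from h) U.2 hη)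
  have h3 := Order.coheight_add_one_le h1'
  have h4 := Order.coheight_add_one_le h2
  rw [hx] at h3
  have h5 : (1 : ℕ∞) ≤ Order.coheight (g ⟨s, hs⟩) := le_trans le_add_self h4
  have h6 : (1 : ℕ∞) + 1 ≤ 1 := le_trans (by gcongr) h3
  exact absurd h6 (by decide)

theorem finite_exDiv {X Y : Scheme.{u}} [IsNoetherian X] [IrreducibleSpace X]
    (p : X.PartialIso Y) : (exDiv p.toRationalMap).Finite :=
  (finite_codimOne X p.source p.dense_source.nonempty).subset
    fun _ hx => ⟨hx.1, fun h => hx.2 ⟨p, rfl, h⟩⟩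

end exceptional

section invariants
variable {k : Type u} [Field k]

/-- The relative Burnside group: free abelian group on the isomorphism classes of the groupoid of
varieties `V / F` over finitely generated extensions `F` of `k`. -/
abbrev RelBurn (k : Type u) [Field k] : Type (u + 1) :=
  FreeAbelianGroup (Quotient (RelVariety.setoid k))

/-- The class `[V / F]` in the relative Burnside group. -/
def RelVariety.cls (R : RelVariety k) : RelBurn k := FreeAbelianGroup.of ⟦R⟧

/-- The forgetful homomorphism, sending `[V / F]` to the class of the `k`-varieties with function
field `F(V)`. -/
noncomputable def forget (k : Type u) [Field k] : RelBurn k →+ Burn k :=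
  FreeAbelianGroup.lift (Quotient.lift (fun R => (RelVariety.exists_isModel R).choose.cls)
    fun R R' h => congrArg FreeAbelianGroup.of (Quotient.sound
      (RelVariety.IsModel.equiv (RelVariety.exists_isModel R).choose_spec
        (RelVariety.exists_isModel R').choose_spec h)))

/-- The motivic invariant `c(φ)` of a birational map `φ : V ⤏ W` between varieties over `k`: the sum
of the classes of the exceptional divisors of `φ⁻¹` minus that of the exceptional divisors of
`φ`. -/
noncomputable def motivicInv {V W : Variety k} (φ : V.X.PartialIso W.X) : Burn k :=
  ∑ x ∈ (finite_exDiv φ.symm).toFinset, (W.closurePt x).cls -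
    ∑ x ∈ (finite_exDiv φ).toFinset, (V.closurePt x).cls

/-- The variety `E / F`, for the closure `E` of a point of `V`, where `R` is `V / F`. -/
noncomputable def RelVariety.closurePt (R : RelVariety k) (x : R.V.X) : RelVariety k where
  F := R.F
  fg := R.fg
  V := R.V.closurePt x

/-- The motivic invariant `c(φ)` of a birational map `φ : V / F ⤏ V' / F'` of varieties over
finitely generated extensions of `k`. -/
noncomputable def relMotivicInv {R R' : RelVariety k} (φ : R.V.X.PartialIso R'.V.X) : RelBurn k :=
  ∑ x ∈ (finite_exDiv φ.symm).toFinset, (R'.closurePt x).cls -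
    ∑ x ∈ (finite_exDiv φ).toFinset, (R.closurePt x).cls

end invariants

section genericFibre

instance flat_fromSpecStalk (X : Scheme.{u}) (x : X) : Flat (X.fromSpecStalk x) := by
  obtain ⟨U, hU, hxU, -⟩ := exists_isAffineOpen_mem_and_subset
    (TopologicalSpace.Opens.mem_top x)
  rw [← hU.fromSpecStalk_eq_fromSpecStalk hxU]
  dsimp [IsAffineOpen.fromSpecStalk]
  have : Flat (Spec.map (X.presheaf.germ U x hxU)) := by
    rw [Flat.SpecMap_iff]
    let _ : Algebra Γ(X, U) (X.presheaf.stalk x) := (X.presheaf.germ U x hxU).hom.toAlgebra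
    have := hU.isLocalization_stalk ⟨x, hxU⟩
    exact IsLocalization.flat (R := Γ(X, U)) (X.presheaf.stalk x)
      (hU.primeIdealOf ⟨x, hxU⟩).asIdeal.primeCompl
  infer_instance

theorem stalkMap_bijective {X Y : Scheme.{u}} (f : X ⟶ Y) [Flat f] [IsPreimmersion f] (x : X) :
    Function.Bijective (f.stalkMap x) := by
  refine ⟨?_, f.stalkMap_surjective x⟩
  algebraize [(f.stalkMap x).hom]
  have : Module.Flat (Y.presheaf.stalk (f x)) (X.presheaf.stalk x) := Flat.stalkMap f x
  have : IsLocalHom (algebraMap (Y.presheaf.stalk (f x)) (X.presheaf.stalk x)) :=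
    inferInstanceAs (IsLocalHom (f.stalkMap x).hom)
  have : Module.FaithfullyFlat (Y.presheaf.stalk (f x)) (X.presheaf.stalk x) :=
    Module.FaithfullyFlat.of_flat_of_isLocalHom
  exact FaithfulSMul.algebraMap_injective (Y.presheaf.stalk (f x)) (X.presheaf.stalk x)

theorem fromSpecStalk_genericPoint {X : Scheme.{u}} [IsIntegral X] (x : Spec X.functionField) :
    X.fromSpecStalk (genericPoint X) x = genericPoint X := by
  have : x = IsLocalRing.closedPoint X.functionField :=
    Subsingleton.elim (α := PrimeSpectrum X.functionField) _ _
  rw [this]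
  exact fromSpecStalk_closedPoint

theorem genericFibre_spec {X Y : Scheme.{u}} [IsIntegral X] [IsIntegral Y] (f : X ⟶ Y)
    [IsDominant f] : ∃ _ : IsIntegral (pullback f (Y.fromSpecStalk (genericPoint Y))),
      pullback.fst f (Y.fromSpecStalk (genericPoint Y)) (genericPoint _) = genericPoint X := by
  set g := pullback.fst f (Y.fromSpecStalk (genericPoint Y)) with hg
  have : Nonempty (Spec Y.functionField) := inferInstanceAs (Nonempty (PrimeSpectrum _))
  obtain ⟨z, hz, -⟩ := Pullback.exists_preimage_pullback (f := f)
    (g := Y.fromSpecStalk (genericPoint Y)) (genericPoint X)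
    (Classical.arbitrary (Spec Y.functionField))
    ((map_genericPoint f).trans (fromSpecStalk_genericPoint _).symm)
  have hz : g z = genericPoint X := hz
  have hgen : IsGenericPoint z (Set.univ : Set ↥(pullback f (Y.fromSpecStalk (genericPoint Y)))) := by
    rw [isGenericPoint_def, Set.eq_univ_iff_forall]
    intro y
    rw [← specializes_iff_mem_closure, ← g.isEmbedding.isInducing.specializes_iff, hz]
    exact genericPoint_specializes _
  have : IrreducibleSpace ↥(pullback f (Y.fromSpecStalk (genericPoint Y))) :=
    { isPreirreducible_univ := (hgen ▸ isIrreducible_singleton.closure : IsIrreducible _).2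
      toNonempty := ⟨z⟩ }
  have hst : ∀ x, _root_.IsReduced
      ((pullback f (Y.fromSpecStalk (genericPoint Y))).presheaf.stalk x) := fun x =>
    isReduced_of_injective (RingEquiv.ofBijective (g.stalkMap x).hom
      (stalkMap_bijective g x)).symm.toRingHom (RingEquiv.injective _)
  have : IsReduced (pullback f (Y.fromSpecStalk (genericPoint Y))) :=
    isReduced_of_isReduced_stalk _
  refine ⟨isIntegral_of_irreducibleSpace_of_isReduced _, ?_⟩
  rw [← hz]
  congr 1
  exact (genericPoint_spec _).eq hgen

end genericFibre

/-- A dominant rational map `X ⤏ B` of `k`-varieties. -/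
structure DominantMap {k : Type u} [Field k] (X B : Variety k) : Type u where
  map : X.X ⤏ B.X
  isDominant : map.IsDominant
  isOver : map.compHom B.str = X.str.toRationalMap

namespace DominantMap
variable {k : Type u} [Field k] {X B : Variety k} (π : DominantMap X B)

instance : π.map.IsDominant := π.isDominant

/-- The morphism to `B` from the complement of the indeterminacy locus of `π`. -/
noncomputable def partialMap : X.X.PartialMap B.X := π.map.toPartialMap

theorem partialMap_toRationalMap : π.partialMap.toRationalMap = π.map :=
  π.map.toRationalMap_toPartialMap

instance : IsDominant π.partialMap.hom := by
  rw [← PartialMap.isDominant_toRationalMap_iff, partialMap_toRationalMap]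
  infer_instance

instance : Nonempty π.partialMap.domain := ⟨⟨_, generic_mem π.partialMap⟩⟩

instance : IsIntegral π.partialMap.domain.toScheme :=
  isIntegral_of_isOpenImmersion π.partialMap.domain.ι

theorem partialMap_isOver : π.partialMap.hom ≫ B.str = π.partialMap.domain.ι ≫ X.str := by
  have h := π.isOver
  rw [← π.partialMap_toRationalMap, ← RationalMap.compHom_toRationalMap] at h
  have h' := PartialMap.toRationalMap_eq_iff.mp h
  exact (PartialMap.equiv_toPartialMap_iff_of_isSeparated (S := ⊤_ _)).mp h'

instance : IsSeparated π.partialMap.hom := by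
  have : IsSeparated (π.partialMap.hom ≫ B.str) := by
    rw [partialMap_isOver]; infer_instance
  exact IsSeparated.of_comp _ B.str

instance : LocallyOfFiniteType π.partialMap.hom := by
  have : LocallyOfFiniteType (π.partialMap.hom ≫ B.str) := by
    rw [partialMap_isOver]; infer_instance
  exact locallyOfFiniteType_of_comp _ B.str

instance : QuasiCompact π.partialMap.hom := by
  have : QuasiCompact (π.partialMap.hom ≫ B.str) := by
    rw [partialMap_isOver]; infer_instance
  exact QuasiCompact.of_comp _ B.str

/-- The generic fibre of `π`, where `π` is restricted to its domain of definition. -/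
noncomputable abbrev fibre : Scheme.{u} :=
  pullback π.partialMap.hom (B.X.fromSpecStalk (genericPoint B.X))

instance : IsIntegral π.fibre := (genericFibre_spec π.partialMap.hom).choose

/-- The generic fibre of `π`, as a variety over the function field of `B`. -/
noncomputable def genericFibre : Variety B.X.functionField where
  X := π.fibre
  str := pullback.snd _ _
  isVariety := ⟨inferInstance, inferInstance, inferInstance, inferInstance⟩

/-- The generic fibre of `π` over the function field of `B`, as an extension of `k`. -/
noncomputable def relGenericFibre : RelVariety k :=
  letI : Algebra k B.X.functionField := (stalkHom B.str (genericPoint B.X)).toAlgebra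
  { F := B.X.functionField
    fg := essFiniteType_stalkHom B.str (genericPoint B.X)
    V := π.genericFibre }

/-- The projection of the generic fibre to the domain of definition of `π`. -/
noncomputable def toDomain : π.relGenericFibre.V.X ⟶ π.partialMap.domain.toScheme :=
  pullback.fst π.partialMap.hom (B.X.fromSpecStalk (genericPoint B.X))

/-- The projection of the generic fibre to `X`. -/
noncomputable def ι : π.relGenericFibre.V.X ⟶ X.X :=
  π.toDomain ≫ π.partialMap.domain.ι

/-- The projection of the generic fibre to the generic point of `B`. -/
noncomputable def str : π.relGenericFibre.V.X ⟶ Spec B.X.functionField :=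
  pullback.snd π.partialMap.hom (B.X.fromSpecStalk (genericPoint B.X))

theorem condition : π.toDomain ≫ π.partialMap.hom = π.str ≫ B.X.fromSpecStalk (genericPoint B.X) :=
  pullback.condition

instance : Flat π.toDomain := inferInstanceAs (Flat (pullback.fst _ _))
instance : IsPreimmersion π.toDomain := inferInstanceAs (IsPreimmersion (pullback.fst _ _))
instance : Flat π.ι := inferInstanceAs (Flat (_ ≫ _))
instance : IsPreimmersion π.ι := inferInstanceAs (IsPreimmersion (_ ≫ _))

end DominantMap

section germs

theorem exists_functionFieldIso_of_flat {X Y : Scheme.{u}} [IsIntegral X] [IsIntegral Y]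
    (f : X ⟶ Y) [Flat f] [IsPreimmersion f] (hf : f (genericPoint X) = genericPoint Y) :
    ∃ a : Spec X.functionField ≅ Spec Y.functionField,
      a.hom ≫ Y.fromSpecStalk (genericPoint Y) = X.fromSpecStalk (genericPoint X) ≫ f := by
  have aux : ∀ y, f (genericPoint X) = y → ∃ a : Spec X.functionField ≅ Spec (Y.presheaf.stalk y),
      a.hom ≫ Y.fromSpecStalk y = X.fromSpecStalk (genericPoint X) ≫ f := by
    rintro _ rfl
    have : IsIso (f.stalkMap (genericPoint X)) :=
      (ConcreteCategory.isIso_iff_bijective _).mpr (stalkMap_bijective f _)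
    exact ⟨asIso (Spec.map (f.stalkMap (genericPoint X))), SpecMap_stalkMap_fromSpecStalk f⟩
  exact aux _ hf

theorem isDominant_toPartialMap {X Y : Scheme.{u}} (f : X ⟶ Y) [IsDominant f] :
    IsDominant f.toPartialMap.hom := by
  have : IsDominant (⊤ : X.Opens).ι := Opens.isDominant_ι dense_univ
  have : IsDominant ((⊤ : X.Opens).ι ≫ f) := inferInstance
  exact this

end germs

namespace DominantMap
variable {k : Type u} [Field k]

section
variable {X B : Variety k} (π : DominantMap X B)

theorem ι_genericPoint : π.ι (genericPoint π.relGenericFibre.V.X) = genericPoint X.X := by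
  rw [← genericPoint_eq_of_isOpenImmersion π.partialMap.domain.ι]
  have h := (genericFibre_spec π.partialMap.hom).choose_spec
  rw [← h]
  exact Scheme.Hom.comp_apply _ _ _

instance : IsDominant π.ι := isDominant_of_mem_range _ ⟨_, π.ι_genericPoint⟩

instance : IsDominant π.ι.toPartialMap.hom := isDominant_toPartialMap _

theorem exists_iso : ∃ a : Spec π.relGenericFibre.V.X.functionField ≅ Spec X.X.functionField,
    a.hom ≫ X.X.fromSpecStalk (genericPoint X.X) =
      π.relGenericFibre.V.X.fromSpecStalk (genericPoint _) ≫ π.ι ∧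
    a.hom ≫ π.partialMap.fromFunctionField =
      π.relGenericFibre.V.X.fromSpecStalk (genericPoint _) ≫ π.str ≫
        B.X.fromSpecStalk (genericPoint B.X) := by
  obtain ⟨a, ha⟩ := exists_functionFieldIso_of_flat π.ι π.ι_genericPoint
  refine ⟨a, ha, ?_⟩
  have h1 : a.hom ≫ π.partialMap.domain.fromSpecStalkOfMem _ (generic_mem π.partialMap) =
      π.relGenericFibre.V.X.fromSpecStalk (genericPoint _) ≫
        π.toDomain := by
    rw [← cancel_mono π.partialMap.domain.ι, Category.assoc, Opens.fromSpecStalkOfMem_ι, ha,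
      Category.assoc, ι]
  change a.hom ≫ π.partialMap.domain.fromSpecStalkOfMem _ (generic_mem π.partialMap) ≫
    π.partialMap.hom = _
  rw [reassoc_of% h1, condition]

end

/-- A birational map between dominant rational maps `π₁ : X₁ ⤏ B₁` and `π₂ : X₂ ⤏ B₂`: a
birational map `X₁ ⤏ X₂` descending to a birational map `B₁ ⤏ B₂`. -/
structure BirMap {X₁ B₁ X₂ B₂ : Variety k} (π₁ : DominantMap X₁ B₁) (π₂ : DominantMap X₂ B₂) :
    Type u where
  top : X₁.X.PartialIso X₂.X
  top_isOver : top.IsOver X₁.str X₂.str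
  base : B₁.X.PartialIso B₂.X
  base_isOver : base.IsOver B₁.str B₂.str
  comm : top.toRationalMap.comp π₂.map = π₁.map.comp base.toRationalMap

theorem exists_generic {X₁ B₁ X₂ B₂ : Variety k} {π₁ : DominantMap X₁ B₁}
    {π₂ : DominantMap X₂ B₂} (φ : BirMap π₁ π₂) :
    ∃ g : π₁.relGenericFibre.V.X.PartialIso π₂.relGenericFibre.V.X,
      g.toRationalMap.compHom π₂.ι = π₁.ι.toRationalMap.comp φ.top.toRationalMap := by
  obtain ⟨a₁, h₁, h₁'⟩ := π₁.exists_iso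
  obtain ⟨a₂, h₂, h₂'⟩ := π₂.exists_iso
  obtain ⟨e, he⟩ := exists_functionFieldIso φ.top
  obtain ⟨s, hs⟩ := exists_functionFieldIso φ.base
  obtain ⟨b₁, hb₁⟩ := exists_germ_of_isDominant π₁.partialMap
  have hcomm : (φ.top.toPartialMap.comp π₂.partialMap).fromFunctionField =
      (π₁.partialMap.comp φ.base.toPartialMap).fromFunctionField := by
    have h := φ.comm
    have h' : (φ.top.toPartialMap.comp π₂.partialMap).toRationalMap =
        (π₁.partialMap.comp φ.base.toPartialMap).toRationalMap := by
      rw [← RationalMap.toRationalMap_comp, ← RationalMap.toRationalMap_comp]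
      convert h using 2 <;> exact partialMap_toRationalMap _
    exact congrArg RationalMap.fromFunctionField h'
  rw [fromFunctionField_comp _ _ _ he.symm, fromFunctionField_comp _ _ _ hb₁.symm, ← hs] at hcomm
  have hstr : π₁.relGenericFibre.V.X.fromSpecStalk (genericPoint _) ≫ π₁.str = a₁.hom ≫ b₁ := by
    rw [← cancel_mono (B₁.X.fromSpecStalk (genericPoint B₁.X)), Category.assoc, ← h₁',
      Category.assoc, hb₁]
  have : LocallyOfFiniteType π₂.str := π₂.relGenericFibre.V.isVariety.locallyOfFiniteType
  have : LocallyOfFiniteType π₁.str := π₁.relGenericFibre.V.isVariety.locallyOfFiniteType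
  obtain ⟨g, -, hg⟩ := exists_partialIso (π₁.str ≫ s.hom) π₂.str (a₁ ≪≫ e ≪≫ a₂.symm) (by
    rw [← cancel_mono (B₂.X.fromSpecStalk (genericPoint B₂.X))]
    simp only [Iso.trans_hom, Iso.symm_hom, Category.assoc]
    rw [← h₂', a₂.inv_hom_id_assoc, reassoc_of% hstr]
    exact congrArg (a₁.hom ≫ ·) hcomm)
  refine ⟨g, ?_⟩
  apply RationalMap.eq_of_fromFunctionField_eq
  have hι : π₁.ι.toPartialMap.fromFunctionField =
      a₁.hom ≫ X₁.X.fromSpecStalk (genericPoint X₁.X) := by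
    rw [h₁]
    exact PartialMap.fromSpecStalkOfMem_toPartialMap _ _
  have e1 : (π₁.ι.toRationalMap.comp φ.top.toRationalMap).fromFunctionField =
      a₁.hom ≫ φ.top.toPartialMap.fromFunctionField := by
    refine Eq.trans ?_ (fromFunctionField_comp _ _ _ hι)
    exact congrArg RationalMap.fromFunctionField (RationalMap.toRationalMap_comp _ _)
  have e2 : (g.toRationalMap.compHom π₂.ι).fromFunctionField =
      g.toRationalMap.fromFunctionField ≫ π₂.ι := PartialMap.fromSpecStalkOfMem_compHom _ _ _ _
  rw [e1, e2, hg]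
  simp only [Iso.trans_hom, Iso.symm_hom, Category.assoc]
  rw [← h₂, a₂.inv_hom_id_assoc, he]

/-- The birational map induced by `φ` on generic fibres: the unique one compatible with `φ` under
the projections of the generic fibres to `X₁` and `X₂`. -/
noncomputable def BirMap.generic {X₁ B₁ X₂ B₂ : Variety k} {π₁ : DominantMap X₁ B₁}
    {π₂ : DominantMap X₂ B₂} (φ : BirMap π₁ π₂) :
    π₁.relGenericFibre.V.X.PartialIso π₂.relGenericFibre.V.X :=
  (exists_generic φ).choose

/-- The horizontal motivic invariant: the image of `c(φ^η)` under the forgetful map, where `φ^η` is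
the map induced on generic fibres. -/
noncomputable def BirMap.cHor {X₁ B₁ X₂ B₂ : Variety k} {π₁ : DominantMap X₁ B₁}
    {π₂ : DominantMap X₂ B₂} (φ : BirMap π₁ π₂) : Burn k :=
  forget k (relMotivicInv φ.generic)

/-- The vertical motivic invariant `c(φ) - c_hor(φ)`. -/
noncomputable def BirMap.cVer {X₁ B₁ X₂ B₂ : Variety k} {π₁ : DominantMap X₁ B₁}
    {π₂ : DominantMap X₂ B₂} (φ : BirMap π₁ π₂) : Burn k :=
  motivicInv φ.top - φ.cHor

/-- The elements of `Bir(X / B)`: the birational automorphisms of `π : X ⤏ B` which descend to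
the identity on `B`. -/
abbrev BirOver {X B : Variety k} (π : DominantMap X B) : Type u :=
  {φ : BirMap π π // φ.base.toRationalMap = RationalMap.id B.X}

end DominantMap

end MotivicInv

/-! The map `φ` induces an automorphism `e` of the function field of `X`. Relate points `x` and `y`
of `X` when `e` identifies their local rings (`LocalIsoAt e x y`). Since `X` is separated this is a
partial bijection, and since `X` is of finite type the exceptional divisors of `φ` are exactly the
points of codimension one without a partner on the right (`mem_exDiv_iff`); those of `φ⁻¹` lack a
partner on the left. Partners have the same codimension and isomorphic residue fields over `k`,
hence closures of the same class (`LocalIsoAt.cls_closurePt_eq`).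

The generic fibre embeds into `X` with the same local rings, and its image consists of the points
that `π` sends to the generic point of `B`. So `c_hor(φ)` is the part of `c(φ)` coming from
exceptional divisors in that image (`mem_exDiv_generic_iff`, `forget_sum_cls`), and `c_ver(φ)` is
the part coming from the others, called vertical here.

Because `π ∘ φ = π`, partners have the same value under `π`, and one lies in the domain of `π` if
and only if the other does (`partialMap_eq_of_localIsoAt`). Take a nonempty open `V ⊆ B` avoiding
the values of `π` at the vertical exceptional divisors. The points of codimension one outside
`π⁻¹(V)` form a finite set containing every vertical exceptional divisor of `φ` and `φ⁻¹`, no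
horizontal one, and stable under partnership. In a finite set with a weight-preserving partial
bijection, the unmatched points on the two sides have equal total weight
(`sum_filter_eq_of_partial_bijection`). Hence the vertical contributions cancel. -/

namespace MotivicInv

open CategoryTheory AlgebraicGeometry AlgebraicGeometry.Scheme Limits TopologicalSpace

/-! ### Birational maps and local rings -/

section localIso

/-- The closed point of the spectrum of a local ring. -/
def specClosedPoint (R : CommRingCat.{u}) [IsLocalRing R] : Spec R :=
  IsLocalRing.closedPoint R

theorem fromSpecStalk_specClosedPoint (X : Scheme.{u}) (x : X) :
    X.fromSpecStalk x (specClosedPoint (X.presheaf.stalk x)) = x :=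
  fromSpecStalk_closedPoint

theorem specMap_specClosedPoint {R R' : CommRingCat.{u}} [IsLocalRing R] [IsLocalRing R']
    (f : R ⟶ R') [IsIso f] : Spec.map f (specClosedPoint R') = specClosedPoint R :=
  IsLocalRing.comap_closedPoint f.hom

/-- The inclusion of the generic point into the spectrum of a local ring. -/
noncomputable def stalkGen (X : Scheme.{u}) [IrreducibleSpace X] (x : X) :
    Spec X.functionField ⟶ Spec (X.presheaf.stalk x) :=
  Spec.map (X.presheaf.stalkSpecializes (genericPoint_specializes x))

theorem stalkGen_fromSpecStalk (X : Scheme.{u}) [IrreducibleSpace X] (x : X) :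
    stalkGen X x ≫ X.fromSpecStalk x = X.fromSpecStalk (genericPoint X) :=
  SpecMap_stalkSpecializes_fromSpecStalk _

/-- This reduces equalities of morphisms from the spectrum of a local ring to a separated scheme to
equalities at the generic point. -/
instance isDominant_stalkGen (X : Scheme.{u}) [IsIntegral X] (x : X) :
    IsDominant (stalkGen X x) where
  denseRange := by
    let c : Spec X.functionField := specClosedPoint X.functionField
    intro z
    have h : stalkGen X x c ⤳ z := by
      rw [← (X.fromSpecStalk x).isEmbedding.isInducing.specializes_iff, ← Scheme.Hom.comp_apply,
        stalkGen_fromSpecStalk, fromSpecStalk_genericPoint]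
      exact genericPoint_specializes _
    exact closure_mono (Set.singleton_subset_iff.mpr (Set.mem_range_self c)) h.mem_closure

/-- A birational map with germ `e` at the generic points is a local isomorphism at `x`, with
image `y`: the isomorphism `e` of function fields restricts to the local rings. -/
def LocalIsoAt {X Y : Scheme.{u}} [IrreducibleSpace X] [IrreducibleSpace Y]
    (e : Spec X.functionField ≅ Spec Y.functionField) (x : X) (y : Y) : Prop :=
  ∃ ε : Y.presheaf.stalk y ≅ X.presheaf.stalk x, stalkGen X x ≫ Spec.map ε.hom = e.hom ≫ stalkGen Y y

namespace LocalIsoAt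
variable {X Y Z S : Scheme.{u}} [IsIntegral X] [IsIntegral Y] [IsIntegral Z]
  {e : Spec X.functionField ≅ Spec Y.functionField}
  {e' : Spec Y.functionField ≅ Spec Z.functionField} {x : X} {y : Y} {z : Z}

theorem symm (h : LocalIsoAt e x y) : LocalIsoAt e.symm y x := by
  obtain ⟨ε, hε⟩ := h
  refine ⟨ε.symm, ?_⟩
  rw [Iso.symm_hom, Iso.symm_hom, Iso.eq_inv_comp, ← reassoc_of% hε, ← Spec.map_comp,
    ε.inv_hom_id, Spec.map_id, Category.comp_id]

theorem trans (h : LocalIsoAt e x y) (h' : LocalIsoAt e' y z) : LocalIsoAt (e ≪≫ e') x z := by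
  obtain ⟨ε, hε⟩ := h
  obtain ⟨ε', hε'⟩ := h'
  refine ⟨ε' ≪≫ ε, ?_⟩
  rw [Iso.trans_hom, Spec.map_comp, reassoc_of% hε, hε', Iso.trans_hom, Category.assoc]

theorem gen_comp_eq (ε : Y.presheaf.stalk y ≅ X.presheaf.stalk x)
    (hε : stalkGen X x ≫ Spec.map ε.hom = e.hom ≫ stalkGen Y y) :
    stalkGen X x ≫ Spec.map ε.hom ≫ Y.fromSpecStalk y =
      e.hom ≫ Y.fromSpecStalk (genericPoint Y) := by
  rw [reassoc_of% hε, stalkGen_fromSpecStalk]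

/-- Both local isomorphisms give morphisms from the spectrum of the local ring at `x` to `Y` that
agree generically, hence everywhere as `Y` is separated. The closed point goes to `y` under one and
to `y'` under the other. -/
theorem unique_right [Y.IsSeparated] {y' : Y} (h : LocalIsoAt e x y) (h' : LocalIsoAt e x y') :
    y = y' := by
  obtain ⟨ε, hε⟩ := h
  obtain ⟨ε', hε'⟩ := h'
  have := ext_of_isDominant (stalkGen X x)
    ((gen_comp_eq ε hε).trans (gen_comp_eq ε' hε').symm)
  have := congr($this (specClosedPoint (X.presheaf.stalk x)))
  rw [Scheme.Hom.comp_apply, Scheme.Hom.comp_apply, specMap_specClosedPoint,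
    specMap_specClosedPoint] at this
  rwa [fromSpecStalk_specClosedPoint, fromSpecStalk_specClosedPoint] at this

theorem unique_left [X.IsSeparated] {x' : X} (h : LocalIsoAt e x y) (h' : LocalIsoAt e x' y) :
    x = x' := unique_right h.symm h'.symm

/-- Codimension is the Krull dimension of the local ring. -/
theorem coheight_eq (h : LocalIsoAt e x y) : Order.coheight x = Order.coheight y := by
  obtain ⟨ε, -⟩ := h
  have h := ringKrullDim_eq_of_ringEquiv ε.commRingCatIsoToRingEquiv
  rw [ringKrullDim_stalk_eq_coheight, ringKrullDim_stalk_eq_coheight] at h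
  exact (WithBot.coe_injective h).symm

/-- Compatibility with `S` need only be assumed on function fields: the two structure morphisms
agree generically and `S` is separated. -/
theorem isOver [S.IsSeparated] {sX : X ⟶ S} {sY : Y ⟶ S}
    (he : e.hom ≫ Y.fromSpecStalk _ ≫ sY = X.fromSpecStalk _ ≫ sX)
    (ε : Y.presheaf.stalk y ≅ X.presheaf.stalk x)
    (hε : stalkGen X x ≫ Spec.map ε.hom = e.hom ≫ stalkGen Y y) :
    Spec.map ε.hom ≫ Y.fromSpecStalk y ≫ sY = X.fromSpecStalk x ≫ sX := by
  apply ext_of_isDominant (stalkGen X x)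
  rw [← Category.assoc, ← Category.assoc, Category.assoc _ _ (Y.fromSpecStalk y),
    gen_comp_eq ε hε, Category.assoc, he, ← Category.assoc, stalkGen_fromSpecStalk]

/-- Morphisms of which the stalk maps are isomorphisms at `w`. -/
theorem of_stalkMap {W : Scheme.{u}} [IsIntegral W] (f : W ⟶ X)
    (e : Spec W.functionField ≅ Spec X.functionField)
    (he : e.hom ≫ X.fromSpecStalk _ = W.fromSpecStalk _ ≫ f) (w : W) [IsIso (f.stalkMap w)] :
    LocalIsoAt e w (f w) := by
  refine ⟨asIso (f.stalkMap w), ?_⟩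
  rw [← cancel_mono (X.fromSpecStalk (f w)), Category.assoc, Category.assoc, asIso_hom,
    SpecMap_stalkMap_fromSpecStalk, stalkGen_fromSpecStalk, ← Category.assoc,
    stalkGen_fromSpecStalk, he]

end LocalIsoAt

theorem fromSpecStalkOfMem_gen {X Y : Scheme.{u}} [IsIntegral X] (f : X.PartialMap Y) {x : X} (hx : x ∈ f.domain) :
    stalkGen X x ≫ f.fromSpecStalkOfMem hx = f.fromFunctionField := by
  change _ ≫ f.domain.fromSpecStalkOfMem _ _ ≫ f.hom =
    f.domain.fromSpecStalkOfMem _ (generic_mem f) ≫ f.hom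
  rw [← Category.assoc]
  congr 1
  rw [← cancel_mono f.domain.ι, Category.assoc, Opens.fromSpecStalkOfMem_ι,
    Opens.fromSpecStalkOfMem_ι, stalkGen_fromSpecStalk]

theorem fromSpecStalkOfMem_specClosedPoint {X : Scheme.{u}} (U : X.Opens) {x : X} (hx : x ∈ U) :
    U.fromSpecStalkOfMem x hx (specClosedPoint (X.presheaf.stalk x)) = ⟨x, hx⟩ := by
  apply U.ι.isOpenEmbedding.injective
  rw [← Scheme.Hom.comp_apply, Opens.fromSpecStalkOfMem_ι,
    fromSpecStalk_specClosedPoint]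
  rfl

theorem partialMap_fromSpecStalkOfMem_specClosedPoint {X Y : Scheme.{u}} (f : X.PartialMap Y) {x : X} (hx : x ∈ f.domain) :
    f.fromSpecStalkOfMem hx (specClosedPoint (X.presheaf.stalk x)) = f.hom ⟨x, hx⟩ := by
  change (f.domain.fromSpecStalkOfMem _ _ ≫ f.hom) _ = _
  rw [Scheme.Hom.comp_apply, fromSpecStalkOfMem_specClosedPoint]

variable {X Y S : Scheme.{u}} [IsIntegral X] [IsIntegral Y]

/-- A partial isomorphism is a local isomorphism at the points of its source. -/
theorem exists_localIsoAt_of_mem_source (p : X.PartialIso Y)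
    (e : Spec X.functionField ≅ Spec Y.functionField)
    (he : e.hom ≫ Y.fromSpecStalk _ = p.toPartialMap.fromFunctionField) {x : X}
    (hx : x ∈ p.source) : ∃ y, LocalIsoAt e x y := by
  have : Nonempty p.source.toScheme := ⟨⟨x, hx⟩⟩
  have : IsIntegral p.source.toScheme := isIntegral_of_isOpenImmersion p.source.ι
  -- The source of `p` maps to `X` and to `Y` by open immersions, which are isomorphisms on stalks;
  -- the claim follows by composing one with the inverse of the other.
  obtain ⟨a, ha⟩ := exists_functionFieldIso_of_flat p.source.ι
    (genericPoint_eq_of_isOpenImmersion _)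
  let w : p.source.toScheme := ⟨x, hx⟩
  have h1 : LocalIsoAt a w x := .of_stalkMap p.source.ι a ha w
  have ha' : a.hom ≫ p.source.fromSpecStalkOfMem _ (show genericPoint X ∈ p.source from generic_mem p.toPartialMap) =
      p.source.toScheme.fromSpecStalk _ := by
    rw [← cancel_mono p.source.ι, Category.assoc, Opens.fromSpecStalkOfMem_ι, ha]
  refine ⟨(p.iso.hom ≫ p.target.ι) w, ?_⟩
  have h2 : LocalIsoAt (a ≪≫ e) w ((p.iso.hom ≫ p.target.ι) w) := by
    refine .of_stalkMap (p.iso.hom ≫ p.target.ι) (a ≪≫ e) ?_ w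
    rw [Iso.trans_hom, Category.assoc, he, ← reassoc_of% ha']
    rfl
  simpa [← Iso.trans_assoc] using h1.symm.trans h2

/-- Beyond `exists_partialIso_aux`, the source is identified explicitly, so that a prescribed point
can be shown to lie in it. -/
theorem exists_partialIso_of_inverse [X.IsSeparated] [Y.IsSeparated]
    (f : X.PartialMap Y) (g : Y.PartialMap X) [IsDominant f.hom] [IsDominant g.hom]
    (hfg : (f.comp g).equiv (PartialMap.id X)) (hgf : (g.comp f).equiv (PartialMap.id Y)) :
    ∃ p : X.PartialIso Y, p.source = (f.comp g).domain ∧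
      ∃ i : p.source.toScheme ⟶ f.domain.toScheme, i ≫ f.domain.ι = p.source.ι ∧
        i ≫ f.hom = p.iso.hom ≫ p.target.ι := by
  obtain ⟨hU, hV, h1, h2, h3⟩ := comp_data f g
  obtain ⟨kV, kU, k1, k2, k3⟩ := comp_data g f
  rw [(PartialMap.equiv_toPartialMap_iff_of_isSeparated (S := ⊤_ _)).mp hfg,
    Category.comp_id] at h3
  rw [(PartialMap.equiv_toPartialMap_iff_of_isSeparated (S := ⊤_ _)).mp hgf,
    Category.comp_id] at k3
  obtain ⟨a, ha⟩ := comp_lift g f hV fun x => by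
    rw [← Scheme.Hom.comp_apply, h3, ← h1, Scheme.Hom.comp_apply]
    exact (hU x).2
  obtain ⟨b, hb⟩ := comp_lift f g kU fun x => by
    rw [← Scheme.Hom.comp_apply, k3, ← k1, Scheme.Hom.comp_apply]
    exact (kV x).2
  have e1 : a ≫ kV = hV := by rw [← cancel_mono g.domain.ι, Category.assoc, k1, ha]
  have e2 : b ≫ hU = kU := by rw [← cancel_mono f.domain.ι, Category.assoc, h1, hb]
  refine ⟨⟨(f.comp g).domain, (f.comp g).dense_domain, (g.comp f).domain, (g.comp f).dense_domain,
    ⟨a, b, ?_, ?_⟩⟩, rfl, hU, h1, ?_⟩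
  · rw [← cancel_mono (f.comp g).domain.ι, Category.assoc, hb, ← k2, reassoc_of% e1, h3,
      Category.id_comp]
  · rw [← cancel_mono (g.comp f).domain.ι, Category.assoc, ha, ← h2, reassoc_of% e2, k3,
      Category.id_comp]
  · change hU ≫ f.hom = a ≫ (g.comp f).domain.ι
    rw [ha, h2]

/-- An isomorphism of local rings over `S` spreads out to a partial isomorphism. -/
theorem LocalIsoAt.exists_partialIso {sX : X ⟶ S} {sY : Y ⟶ S} [LocallyOfFiniteType sX]
    [LocallyOfFiniteType sY] [X.IsSeparated] [Y.IsSeparated] [S.IsSeparated]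
    {e : Spec X.functionField ≅ Spec Y.functionField}
    (he : e.hom ≫ Y.fromSpecStalk _ ≫ sY = X.fromSpecStalk _ ≫ sX) {x : X} {y : Y}
    (h : LocalIsoAt e x y) : ∃ p : X.PartialIso Y, x ∈ p.source ∧
      p.toRationalMap.fromFunctionField = e.hom ≫ Y.fromSpecStalk _ := by
  have he' : e.symm.hom ≫ X.fromSpecStalk _ ≫ sX = Y.fromSpecStalk _ ≫ sY := by
    rw [← he, Iso.symm_hom, e.inv_hom_id_assoc]
  obtain ⟨ε, hε⟩ := h
  obtain ⟨ε', hε'⟩ := LocalIsoAt.symm ⟨ε, hε⟩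
  have ho : (Spec.map ε.hom ≫ Y.fromSpecStalk y) ≫ sY = X.fromSpecStalk x ≫ sX := by
    rw [Category.assoc]; exact LocalIsoAt.isOver he ε hε
  have ho' : (Spec.map ε'.hom ≫ X.fromSpecStalk x) ≫ sX = Y.fromSpecStalk y ≫ sY := by
    rw [Category.assoc]; exact LocalIsoAt.isOver he' ε' hε'
  -- Finite type over `S` spreads the two inverse maps of local schemes out to neighbourhoods of `x`
  -- and `y`. That they are inverse as rational maps is checked at the generic points only.
  let f : X.PartialMap Y := PartialMap.ofFromSpecStalk sX sY _ ho
  let g : Y.PartialMap X := PartialMap.ofFromSpecStalk sY sX _ ho'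
  have hx : x ∈ f.domain := PartialMap.mem_domain_ofFromSpecStalk _ _ _ _
  have hy : y ∈ g.domain := PartialMap.mem_domain_ofFromSpecStalk _ _ _ _
  have hfx : f.fromSpecStalkOfMem hx = _ :=
    PartialMap.fromSpecStalkOfMem_ofFromSpecStalk sX sY _ ho
  have hgy : g.fromSpecStalkOfMem hy = _ :=
    PartialMap.fromSpecStalkOfMem_ofFromSpecStalk sY sX _ ho'
  have hf : f.fromFunctionField = e.hom ≫ Y.fromSpecStalk _ := by
    rw [← fromSpecStalkOfMem_gen f hx, hfx, LocalIsoAt.gen_comp_eq ε hε]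
  have hg : g.fromFunctionField = e.inv ≫ X.fromSpecStalk _ := by
    rw [← fromSpecStalkOfMem_gen g hy, hgy, LocalIsoAt.gen_comp_eq ε' hε', Iso.symm_hom]
  have := isDominant_of_germ f _ hf
  have := isDominant_of_germ g _ hg
  have hfg : (f.comp g).equiv (PartialMap.id X) := by
    refine PartialMap.equiv_of_fromSpecStalkOfMem_eq _ _ (generic_mem _) (generic_mem _) ?_
    refine (fromFunctionField_comp f g _ hf).trans ?_
    rw [hg, e.hom_inv_id_assoc]
    refine Eq.trans ?_ (PartialMap.fromSpecStalkOfMem_toPartialMap _ _).symm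
    simp
  have hgf : (g.comp f).equiv (PartialMap.id Y) := by
    refine PartialMap.equiv_of_fromSpecStalkOfMem_eq _ _ (generic_mem _) (generic_mem _) ?_
    refine (fromFunctionField_comp g f _ hg).trans ?_
    rw [hf, e.inv_hom_id_assoc]
    refine Eq.trans ?_ (PartialMap.fromSpecStalkOfMem_toPartialMap _ _).symm
    simp
  obtain ⟨p, hp, i, hi, hi'⟩ := exists_partialIso_of_inverse f g hfg hgf
  refine ⟨p, ?_, ?_⟩
  -- The source is the domain of `f` followed by `g`. It contains `x`, because `f` sends `x` to `y`:
  -- an isomorphism of local rings matches the closed points.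
  · rw [hp]
    refine ⟨⟨x, hx⟩, ?_, rfl⟩
    change f.hom ⟨x, hx⟩ ∈ g.domain
    rw [← partialMap_fromSpecStalkOfMem_specClosedPoint, hfx, Scheme.Hom.comp_apply,
      specMap_specClosedPoint, fromSpecStalk_specClosedPoint]
    exact hy
  · rw [← hf]
    change p.source.fromSpecStalkOfMem _ (generic_mem p.toPartialMap) ≫ p.iso.hom ≫ p.target.ι =
      f.domain.fromSpecStalkOfMem _ (generic_mem f) ≫ f.hom
    rw [← hi', ← Category.assoc]
    congr 1
    rw [← cancel_mono f.domain.ι, Category.assoc, hi, Opens.fromSpecStalkOfMem_ι]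
    exact Opens.fromSpecStalkOfMem_ι _ _ _

/-- The exceptional divisors are the points of codimension one without local isomorphism. -/
theorem mem_exDiv_iff {sX : X ⟶ S} {sY : Y ⟶ S} [LocallyOfFiniteType sX]
    [LocallyOfFiniteType sY] [X.IsSeparated] [Y.IsSeparated] [S.IsSeparated]
    (p : X.PartialIso Y) {e : Spec X.functionField ≅ Spec Y.functionField}
    (hp : e.hom ≫ Y.fromSpecStalk _ = p.toPartialMap.fromFunctionField)
    (he : e.hom ≫ Y.fromSpecStalk _ ≫ sY = X.fromSpecStalk _ ≫ sX) {x : X} :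
    x ∈ exDiv p.toRationalMap ↔ Order.coheight x = 1 ∧ ∀ y, ¬ LocalIsoAt e x y := by
  refine and_congr_right fun _ => ?_
  rw [← not_exists, not_iff_not]
  constructor
  · rintro ⟨q, hq, hx⟩
    refine exists_localIsoAt_of_mem_source q e ?_ hx
    rw [hp]
    exact congrArg RationalMap.fromFunctionField hq.symm
  · rintro ⟨y, h⟩
    obtain ⟨q, hx, hq⟩ := h.exists_partialIso he
    -- `q` may have another source than `p`, but `exDiv` depends only on the rational map, which the
    -- germ `e` determines.
    exact ⟨q, RationalMap.eq_of_fromFunctionField_eq _ _ (hq.trans hp), hx⟩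

end localIso

/-! ### Closures of points and their classes -/

section closure

/-- The function field of an integral closed subscheme is the residue field at its generic
point. -/
theorem exists_functionField_iso_residueField {X Z : Scheme.{u}} [IsIntegral Z] (i : Z ⟶ X)
    [IsClosedImmersion i] {x : X} (hx : i (genericPoint Z) = x) :
    ∃ e : Spec Z.functionField ≅ Spec (X.residueField x),
      e.hom ≫ X.fromSpecResidueField x = Z.fromSpecStalk (genericPoint Z) ≫ i := by
  subst hx
  -- The stalk of an integral scheme at its generic point is a field, so it equals its residue
  -- field.
  have h1 : IsIso (Z.residue (genericPoint Z)) :=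
    (ConcreteCategory.isIso_iff_bijective _).mpr
      ⟨RingHom.injective (R := Z.functionField) (Z.residue (genericPoint Z)).hom,
        Z.residue_surjective _⟩
  -- A closed immersion is surjective on stalks, hence on residue fields, where injectivity is
  -- automatic.
  have h2 : IsIso (i.residueFieldMap (genericPoint Z)) := by
    refine (ConcreteCategory.isIso_iff_bijective _).mpr
      ⟨RingHom.injective (i.residueFieldMap (genericPoint Z)).hom, ?_⟩
    have h : Function.Surjective
        (X.residue (i (genericPoint Z)) ≫ i.residueFieldMap (genericPoint Z)) := by
      rw [residue_residueFieldMap]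
      exact (Z.residue_surjective _).comp (i.stalkMap_surjective _)
    exact .of_comp (g := X.residue (i (genericPoint Z))) h
  refine ⟨(asIso (Spec.map (Z.residue (genericPoint Z)))).symm ≪≫
    asIso (Spec.map (i.residueFieldMap (genericPoint Z))), ?_⟩
  rw [Iso.trans_hom, Category.assoc, asIso_hom,
    Hom.SpecMap_residueFieldMap_fromSpecResidueField, Iso.symm_hom, Iso.inv_comp_eq]
  rfl

instance (X : Scheme.{u}) (x : X) :
    IsIntegral (IdealSheafData.vanishingIdeal (X := X) (.closure {x})).subscheme :=
  isIntegral_closure X x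

theorem subschemeι_genericPoint (X : Scheme.{u}) (x : X) :
    (IdealSheafData.vanishingIdeal (X := X) (.closure {x})).subschemeι (genericPoint _) = x := by
  set i := (IdealSheafData.vanishingIdeal (X := X) (.closure {x})).subschemeι
  have h := (genericPoint_spec
    (IdealSheafData.vanishingIdeal (X := X) (.closure {x})).subscheme).image i.continuous
  have hr : Set.range i = closure {x} := by
    simp only [i, IdealSheafData.range_subschemeι]
    simp
  rw [Set.image_univ, hr, closure_closure] at h
  exact h.eq isGenericPoint_closure

/-- An isomorphism of local rings over `S` identifies the generic points of the closures. -/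
theorem LocalIsoAt.exists_closure_iso {X Y S : Scheme.{u}} [IsIntegral X] [IsIntegral Y]
    [S.IsSeparated] {sX : X ⟶ S} {sY : Y ⟶ S}
    {e : Spec X.functionField ≅ Spec Y.functionField}
    (he : e.hom ≫ Y.fromSpecStalk _ ≫ sY = X.fromSpecStalk _ ≫ sX) {x : X} {y : Y}
    (h : LocalIsoAt e x y) :
    ∃ e' : Spec (IdealSheafData.vanishingIdeal (X := X) (.closure {x})).subscheme.functionField ≅
        Spec (IdealSheafData.vanishingIdeal (X := Y) (.closure {y})).subscheme.functionField,
      e'.hom ≫ fromSpecStalk _ _ ≫ (IdealSheafData.vanishingIdeal (.closure {y})).subschemeι ≫ sY =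
        fromSpecStalk _ _ ≫ (IdealSheafData.vanishingIdeal (.closure {x})).subschemeι ≫ sX := by
  obtain ⟨ε, hε⟩ := h
  have ho := LocalIsoAt.isOver he ε hε
  obtain ⟨a, ha⟩ := exists_functionField_iso_residueField _ (subschemeι_genericPoint X x)
  obtain ⟨b, hb⟩ := exists_functionField_iso_residueField _ (subschemeι_genericPoint Y y)
  let r : Y.residueField y ≅ X.residueField x :=
    (IsLocalRing.ResidueField.mapEquiv ε.commRingCatIsoToRingEquiv).toCommRingCatIso
  have hr : Y.residue y ≫ r.hom = ε.hom ≫ X.residue x := by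
    ext t
    rfl
  have hr' : Spec.map r.hom ≫ Y.fromSpecResidueField y ≫ sY = X.fromSpecResidueField x ≫ sX := by
    rw [fromSpecResidueField, fromSpecResidueField, Category.assoc, Category.assoc, ← ho,
      ← reassoc_of% Spec.map_comp, hr, Spec.map_comp_assoc]
  refine ⟨a ≪≫ asIso (Spec.map r.hom) ≪≫ b.symm, ?_⟩
  rw [← reassoc_of% ha, ← reassoc_of% hb, Iso.trans_hom, Iso.trans_hom, Category.assoc,
    Category.assoc, Iso.symm_hom, b.inv_hom_id_assoc, asIso_hom, hr']

variable {k : Type u} [Field k]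

/-- Isomorphic local rings have isomorphic residue fields; these are the function fields of the
closures, and they determine the birational class over `k`. -/
theorem LocalIsoAt.cls_closurePt_eq {V W : Variety k}
    {e : Spec V.X.functionField ≅ Spec W.X.functionField}
    (he : e.hom ≫ W.X.fromSpecStalk _ ≫ W.str = V.X.fromSpecStalk _ ≫ V.str) {x : V.X} {y : W.X}
    (h : LocalIsoAt e x y) : (V.closurePt x).cls = (W.closurePt y).cls := by
  obtain ⟨e', he'⟩ := h.exists_closure_iso he
  obtain ⟨p, hp, -⟩ := MotivicInv.exists_partialIso (V.closurePt x).str (W.closurePt y).str e' he'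
  exact congrArg FreeAbelianGroup.of (Quotient.sound ⟨p, hp⟩)

/-- `forget` uses a chosen model; any two models are birational, so the choice is immaterial. -/
theorem forget_cls {R : RelVariety k} {V : Variety k} (h : RelVariety.IsModel V R) :
    forget k R.cls = V.cls := by
  refine (FreeAbelianGroup.lift_apply_of _ _).trans ?_
  exact congrArg FreeAbelianGroup.of (Quotient.sound
    ((RelVariety.exists_isModel R).choose_spec.equiv h (Setoid.refl R)))

end closure

theorem germ_symm {X Y : Scheme.{u}} [IsIntegral X] [IsIntegral Y] (p : X.PartialIso Y)
    (e : Spec X.functionField ≅ Spec Y.functionField)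
    (he : e.hom ≫ Y.fromSpecStalk _ = p.toPartialMap.fromFunctionField) :
    e.symm.hom ≫ X.fromSpecStalk _ = p.symm.toPartialMap.fromFunctionField := by
  have h1 : genericPoint X ∈ p.source := generic_mem p.toPartialMap
  have h2 : genericPoint Y ∈ p.target := generic_mem p.symm.toPartialMap
  change _ = p.source.fromSpecStalkOfMem _ h1 ≫ p.iso.hom ≫ p.target.ι at he
  change _ = p.target.fromSpecStalkOfMem _ h2 ≫ p.iso.inv ≫ p.source.ι
  have h3 : e.hom ≫ p.target.fromSpecStalkOfMem _ h2 =
      p.source.fromSpecStalkOfMem _ h1 ≫ p.iso.hom := by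
    rw [← cancel_mono p.target.ι, Category.assoc, Category.assoc, ← he,
      Opens.fromSpecStalkOfMem_ι]
  rw [Iso.symm_hom, Iso.inv_comp_eq, reassoc_of% h3, p.iso.hom_inv_id_assoc,
    Opens.fromSpecStalkOfMem_ι]

/-! ### Horizontal points and the fibres of `π` -/

namespace DominantMap
variable {k : Type u} [Field k] {X B : Variety k} (π : DominantMap X B)

/-- A birational automorphism over `B` preserves the domain of definition of `π` and the values
of `π` where it is a local isomorphism. -/
theorem partialMap_eq_of_localIsoAt {e : Spec X.X.functionField ≅ Spec X.X.functionField}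
    (he : e.hom ≫ X.X.fromSpecStalk _ ≫ X.str = X.X.fromSpecStalk _ ≫ X.str)
    (hπ : e.hom ≫ π.partialMap.fromFunctionField = π.partialMap.fromFunctionField)
    {x y : X.X} (h : LocalIsoAt e x y) (hx : x ∈ π.partialMap.domain) :
    ∃ hy : y ∈ π.partialMap.domain, π.partialMap.hom ⟨y, hy⟩ = π.partialMap.hom ⟨x, hx⟩ := by
  have he' : e.symm.hom ≫ X.X.fromSpecStalk _ ≫ X.str = X.X.fromSpecStalk _ ≫ X.str := by
    rw [Iso.symm_hom, Iso.inv_comp_eq, he]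
  obtain ⟨ε, hε⟩ := h.symm
  have ho : π.partialMap.fromSpecStalkOfMem hx ≫ B.str = X.X.fromSpecStalk x ≫ X.str := by
    change (π.partialMap.domain.fromSpecStalkOfMem _ _ ≫ _) ≫ _ = _
    rw [Category.assoc, partialMap_isOver, ← Category.assoc, Opens.fromSpecStalkOfMem_ι]
  have hψ : (Spec.map ε.hom ≫ π.partialMap.fromSpecStalkOfMem hx) ≫ B.str =
      X.X.fromSpecStalk y ≫ X.str := by
    rw [Category.assoc, ho, LocalIsoAt.isOver he' ε hε]
  have hgen : stalkGen X.X y ≫ Spec.map ε.hom ≫ π.partialMap.fromSpecStalkOfMem hx =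
      π.partialMap.fromFunctionField := by
    rw [reassoc_of% hε, fromSpecStalkOfMem_gen, Iso.symm_hom, Iso.inv_comp_eq, hπ]
  -- Transporting `π` from `x` to `y` through the local isomorphism gives a map near `y`. By `hπ`
  -- its generic germ is that of `π`, so it represents `π`; the domain of `π`, being the largest
  -- possible, then contains `y`.
  let f : X.X.PartialMap B.X := PartialMap.ofFromSpecStalk X.str B.str _ hψ
  have hyf : y ∈ f.domain := PartialMap.mem_domain_ofFromSpecStalk _ _ _ _
  have hfy : f.fromSpecStalkOfMem hyf = _ :=
    PartialMap.fromSpecStalkOfMem_ofFromSpecStalk X.str B.str _ hψ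
  have hf : f.toRationalMap = π.map := by
    rw [← π.partialMap_toRationalMap]
    apply RationalMap.eq_of_fromFunctionField_eq
    change f.fromFunctionField = π.partialMap.fromFunctionField
    rw [← fromSpecStalkOfMem_gen f hyf, hfy, hgen]
  have hy : y ∈ π.partialMap.domain := RationalMap.mem_domain.mpr ⟨f, hyf, hf⟩
  refine ⟨hy, ?_⟩
  have heq : π.partialMap.fromSpecStalkOfMem hy =
      Spec.map ε.hom ≫ π.partialMap.fromSpecStalkOfMem hx := by
    apply ext_of_isDominant (stalkGen X.X y)
    rw [hgen, fromSpecStalkOfMem_gen]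
  rw [← partialMap_fromSpecStalkOfMem_specClosedPoint, heq, Scheme.Hom.comp_apply,
    specMap_specClosedPoint, partialMap_fromSpecStalkOfMem_specClosedPoint]

/-- For divisors this is horizontality. Points outside the domain of `π` never qualify, and as `X`
need not be normal they can have codimension one. -/
theorem mem_range_ι {x : X.X} : x ∈ Set.range π.ι ↔
    ∃ hx : x ∈ π.partialMap.domain, π.partialMap.hom ⟨x, hx⟩ = genericPoint B.X := by
  constructor
  · rintro ⟨y, rfl⟩
    refine ⟨(π.toDomain y).2, ?_⟩
    change π.partialMap.hom (π.toDomain y) = _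
    rw [← Scheme.Hom.comp_apply, condition, Scheme.Hom.comp_apply]
    exact fromSpecStalk_genericPoint _
  · rintro ⟨hx, h⟩
    obtain ⟨z, hz, -⟩ := Pullback.exists_preimage_pullback (f := π.partialMap.hom)
      (g := B.X.fromSpecStalk (genericPoint B.X)) ⟨x, hx⟩
      (specClosedPoint B.X.functionField) (h.trans (fromSpecStalk_genericPoint _).symm)
    exact ⟨z, congrArg Subtype.val hz⟩

theorem mem_range_ι_iff_of_localIsoAt {e : Spec X.X.functionField ≅ Spec X.X.functionField}
    (he : e.hom ≫ X.X.fromSpecStalk _ ≫ X.str = X.X.fromSpecStalk _ ≫ X.str)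
    (hπ : e.hom ≫ π.partialMap.fromFunctionField = π.partialMap.fromFunctionField)
    {x y : X.X} (h : LocalIsoAt e x y) (hx : x ∈ Set.range π.ι) : y ∈ Set.range π.ι := by
  rw [mem_range_ι] at hx ⊢
  obtain ⟨hx, hx'⟩ := hx
  obtain ⟨hy, hy'⟩ := π.partialMap_eq_of_localIsoAt he hπ h hx
  exact ⟨hy, hy'.trans hx'⟩

/-- A flat preimmersion is bijective on stalks, so the generic fibre has the same local rings as
`X`. -/
theorem localIsoAt_ι {a : Spec π.relGenericFibre.V.X.functionField ≅ Spec X.X.functionField}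
    (ha : a.hom ≫ X.X.fromSpecStalk (genericPoint X.X) =
      π.relGenericFibre.V.X.fromSpecStalk (genericPoint _) ≫ π.ι)
    (y : π.relGenericFibre.V.X) : LocalIsoAt a y (π.ι y) := by
  have : IsIso (π.ι.stalkMap y) :=
    (ConcreteCategory.isIso_iff_bijective _).mpr (stalkMap_bijective π.ι y)
  exact .of_stalkMap π.ι a ha y

theorem toBase_relGenericFibre : π.relGenericFibre.toBase = π.ι ≫ X.str := by
  have h : Spec.map (CommRingCat.ofHom (algebraMap k π.relGenericFibre.F)) =
      B.X.fromSpecStalk (genericPoint B.X) ≫ B.str :=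
    specMap_stalkHom B.str (genericPoint B.X)
  rw [RelVariety.toBase, h]
  change π.str ≫ _ = _
  rw [← Category.assoc, ← condition, Category.assoc, partialMap_isOver, ι, Category.assoc]

/-- The points `y` and `π.ι y` have the same residue field over `k`, so the closure in `X` is a
model of the closure in the generic fibre. -/
theorem forget_cls_closurePt (y : π.relGenericFibre.V.X) :
    forget k (π.relGenericFibre.closurePt y).cls = (X.closurePt (π.ι y)).cls := by
  obtain ⟨a, ha, -⟩ := π.exists_iso
  obtain ⟨e, he⟩ := (π.localIsoAt_ι ha y).symm.exists_closure_iso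
    (sX := X.str) (sY := π.ι ≫ X.str) (by
      rw [← reassoc_of% ha, Iso.symm_hom, a.inv_hom_id_assoc])
  refine forget_cls ⟨e, ?_⟩
  rw [← toBase_relGenericFibre] at he
  refine Eq.trans ?_ he
  congr 2

end DominantMap

/-! ### Counting for finite partial bijections -/

open Classical in
/-- A partial bijection `R` of a finite set preserving a weight: the points outside the source and
the points outside the target have the same total weight. -/
theorem sum_filter_eq_of_partial_bijection {α A : Type*} [AddCommGroup A] (S : Finset α)
    (w : α → A) (R : α → α → Prop) (hw : ∀ x y, R x y → w x = w y)
    (hS : ∀ x y, R x y → (x ∈ S ↔ y ∈ S)) (hr : ∀ x y y', R x y → R x y' → y = y')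
    (hl : ∀ x x' y, R x y → R x' y → x = x') :
    ∑ y ∈ S with ∀ x, ¬ R x y, w y = ∑ x ∈ S with ∀ y, ¬ R x y, w x := by
  have h1 := Finset.sum_filter_add_sum_filter_not S (fun y => ∀ x, ¬ R x y) w
  have h2 := Finset.sum_filter_add_sum_filter_not S (fun x => ∀ y, ¬ R x y) w
  -- `R` matches the points having a right partner with those having a left partner, within `S` and
  -- preserving weights. Subtracting from the total over `S` leaves the unmatched points.
  have h3 : ∑ x ∈ S with ¬ ∀ y, ¬ R x y, w x = ∑ y ∈ S with ¬ ∀ x, ¬ R x y, w y := by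
    have hex : ∀ x ∈ S.filter (fun x => ¬ ∀ y, ¬ R x y), ∃ y, R x y := fun x hx => by
      simpa using (Finset.mem_filter.mp hx).2
    choose! f hf using hex
    refine Finset.sum_bij (fun x _ => f x) ?_ ?_ ?_ ?_
    · intro x hx
      refine Finset.mem_filter.mpr ⟨(hS _ _ (hf x hx)).mp (Finset.mem_filter.mp hx).1, ?_⟩
      exact fun h => h x (hf x hx)
    · intro x hx x' hx' h
      exact hl _ _ _ (hf x hx) (h ▸ hf x' hx')
    · intro y hy
      obtain ⟨hyS, hy⟩ := Finset.mem_filter.mp hy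
      push Not at hy
      obtain ⟨x, hxy⟩ := hy
      have hx : x ∈ S.filter (fun x => ¬ ∀ y, ¬ R x y) :=
        Finset.mem_filter.mpr ⟨(hS _ _ hxy).mpr hyS, fun h => h y hxy⟩
      exact ⟨x, hx, hr _ _ _ (hf x hx) hxy⟩
    · exact fun x hx => hw _ _ (hf x hx)
  rw [h3] at h2
  exact add_right_cancel (h1.trans h2.symm)

/-! ### Horizontal and vertical exceptional divisors -/

namespace DominantMap
variable {k : Type u} [Field k] {X B : Variety k} (π : DominantMap X B)

/-- The assumption that `φ` descends to the identity enters the proof only here. -/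
theorem fromFunctionField_eq_of_base_eq_id (φ : BirOver π)
    {e : Spec X.X.functionField ≅ Spec X.X.functionField}
    (he : e.hom ≫ X.X.fromSpecStalk _ = φ.1.top.toPartialMap.fromFunctionField) :
    e.hom ≫ π.partialMap.fromFunctionField = π.partialMap.fromFunctionField := by
  have h := φ.1.comm
  have h2 : φ.1.top.toRationalMap.comp π.map = π.map := by
    rw [h]
    refine Eq.trans ?_ (RationalMap.comp_id π.map)
    exact congrArg π.map.comp φ.2
  rw [← fromFunctionField_comp _ _ _ he.symm]
  have h' : (φ.1.top.toPartialMap.comp π.partialMap).toRationalMap =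
      π.partialMap.toRationalMap := by
    rw [← RationalMap.toRationalMap_comp, partialMap_toRationalMap]
    exact h2
  exact congrArg RationalMap.fromFunctionField h'

/-- The map on generic fibres is a choice characterised by its compatibility with `φ` through `π.ι`.
As `π.ι` induces the isomorphism `a` of function fields, this forces its germ to be `e` conjugated
by `a`. -/
theorem exists_generic_germ (φ : BirOver π)
    {e : Spec X.X.functionField ≅ Spec X.X.functionField}
    (he : e.hom ≫ X.X.fromSpecStalk _ = φ.1.top.toPartialMap.fromFunctionField)
    {a : Spec π.relGenericFibre.V.X.functionField ≅ Spec X.X.functionField}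
    (ha : a.hom ≫ X.X.fromSpecStalk (genericPoint X.X) =
      π.relGenericFibre.V.X.fromSpecStalk (genericPoint _) ≫ π.ι) :
    (a ≪≫ e ≪≫ a.symm).hom ≫ π.relGenericFibre.V.X.fromSpecStalk (genericPoint _) =
      φ.1.generic.toPartialMap.fromFunctionField := by
  obtain ⟨g, hg⟩ := exists_functionFieldIso φ.1.generic
  have h : φ.1.generic.toRationalMap.compHom π.ι =
      π.ι.toRationalMap.comp φ.1.top.toRationalMap := (exists_generic φ.1).choose_spec
  have hι : π.ι.toPartialMap.fromFunctionField =
      a.hom ≫ X.X.fromSpecStalk (genericPoint X.X) := by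
    rw [ha]
    exact PartialMap.fromSpecStalkOfMem_toPartialMap _ _
  have e1 : (π.ι.toRationalMap.comp φ.1.top.toRationalMap).fromFunctionField =
      a.hom ≫ φ.1.top.toPartialMap.fromFunctionField := by
    refine Eq.trans ?_ (fromFunctionField_comp _ _ _ hι)
    exact congrArg RationalMap.fromFunctionField (RationalMap.toRationalMap_comp _ _)
  have e2 : (φ.1.generic.toRationalMap.compHom π.ι).fromFunctionField =
      φ.1.generic.toPartialMap.fromFunctionField ≫ π.ι :=
    PartialMap.fromSpecStalkOfMem_compHom _ _ _ _
  rw [h, e1, ← hg, ← he, Category.assoc, ← ha] at e2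
  have e3 : a.hom ≫ e.hom = g.hom ≫ a.hom := by
    rw [← cancel_mono (X.X.fromSpecStalk (genericPoint X.X)), Category.assoc, Category.assoc, e2]
  rw [← hg]
  congr 1
  rw [Iso.trans_hom, Iso.trans_hom, reassoc_of% e3, Iso.symm_hom, a.hom_inv_id, Category.comp_id]

/-- The exceptional divisors of the generic fibre are the horizontal exceptional divisors. -/
theorem mem_exDiv_generic_iff
    {e : Spec X.X.functionField ≅ Spec X.X.functionField}
    (he : e.hom ≫ X.X.fromSpecStalk _ ≫ X.str = X.X.fromSpecStalk _ ≫ X.str)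
    (hπ : e.hom ≫ π.partialMap.fromFunctionField = π.partialMap.fromFunctionField)
    (p : X.X.PartialIso X.X)
    (hp : e.hom ≫ X.X.fromSpecStalk _ = p.toPartialMap.fromFunctionField)
    (g : π.relGenericFibre.V.X.PartialIso π.relGenericFibre.V.X)
    {a : Spec π.relGenericFibre.V.X.functionField ≅ Spec X.X.functionField}
    (ha : a.hom ≫ X.X.fromSpecStalk (genericPoint X.X) =
      π.relGenericFibre.V.X.fromSpecStalk (genericPoint _) ≫ π.ι)
    (ha' : a.hom ≫ π.partialMap.fromFunctionField =
      π.relGenericFibre.V.X.fromSpecStalk (genericPoint _) ≫ π.str ≫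
        B.X.fromSpecStalk (genericPoint B.X))
    (hg : (a ≪≫ e ≪≫ a.symm).hom ≫ π.relGenericFibre.V.X.fromSpecStalk (genericPoint _) =
      g.toPartialMap.fromFunctionField) (y : π.relGenericFibre.V.X) :
    y ∈ exDiv g.toRationalMap ↔ π.ι y ∈ exDiv p.toRationalMap := by
  have : LocallyOfFiniteType π.str := π.relGenericFibre.V.isVariety.locallyOfFiniteType
  -- The generic fibre is of finite type over `k(B)`, so spreading out there needs compatibility
  -- with `k(B)`, which `hπ` supplies.
  have hstr : (a ≪≫ e ≪≫ a.symm).hom ≫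
      π.relGenericFibre.V.X.fromSpecStalk (genericPoint _) ≫ π.str =
        π.relGenericFibre.V.X.fromSpecStalk (genericPoint _) ≫ π.str := by
    rw [← cancel_mono (B.X.fromSpecStalk (genericPoint B.X))]
    simp only [Iso.trans_hom, Iso.symm_hom, Category.assoc]
    rw [← ha', a.inv_hom_id_assoc, hπ]
  rw [mem_exDiv_iff g hg hstr, mem_exDiv_iff p hp he, (π.localIsoAt_ι ha y).coheight_eq]
  refine and_congr_right fun _ => ⟨fun h x hx => ?_, fun h z hz => ?_⟩
  -- A partner in `X` of a point of the generic fibre lies on the generic fibre again, so no partner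
  -- is lost by restricting to it.
  · obtain ⟨z, rfl⟩ := π.mem_range_ι_iff_of_localIsoAt he hπ hx ⟨y, rfl⟩
    exact h z ((π.localIsoAt_ι ha y).trans (hx.trans (π.localIsoAt_ι ha z).symm))
  · refine h (π.ι z) ?_
    have := ((π.localIsoAt_ι ha y).symm.trans hz).trans (π.localIsoAt_ι ha z)
    simpa using this

open Classical in
theorem forget_sum_cls (p : X.X.PartialIso X.X)
    (g : π.relGenericFibre.V.X.PartialIso π.relGenericFibre.V.X)
    (h : ∀ y, y ∈ exDiv g.toRationalMap ↔ π.ι y ∈ exDiv p.toRationalMap) :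
    forget k (∑ y ∈ (finite_exDiv g).toFinset, (π.relGenericFibre.closurePt y).cls) =
      ∑ x ∈ (finite_exDiv p).toFinset with x ∈ Set.range π.ι, (X.closurePt x).cls := by
  rw [map_sum]
  refine Finset.sum_bij (fun y _ => π.ι y) ?_ ?_ ?_ ?_
  · intro y hy
    simp only [Set.Finite.mem_toFinset, Finset.mem_filter] at hy ⊢
    exact ⟨(h y).mp hy, y, rfl⟩
  · exact fun y _ y' _ hyy => π.ι.isEmbedding.injective hyy
  · intro x hx
    simp only [Set.Finite.mem_toFinset, Finset.mem_filter] at hx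
    obtain ⟨hx, y, rfl⟩ := hx
    exact ⟨y, by simpa using (h y).mpr hx, rfl⟩
  · exact fun y _ => π.forget_cls_closurePt y

open Classical in
/-- The vertical exceptional divisors of a birational automorphism over `B` and of its inverse
agree in the Burnside group: they lie in a finite set of divisors permuted away from the
exceptional ones. -/
theorem sum_vertical_eq
    {e : Spec X.X.functionField ≅ Spec X.X.functionField}
    (he : e.hom ≫ X.X.fromSpecStalk _ ≫ X.str = X.X.fromSpecStalk _ ≫ X.str)
    (hπ : e.hom ≫ π.partialMap.fromFunctionField = π.partialMap.fromFunctionField)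
    (p : X.X.PartialIso X.X)
    (hp : e.hom ≫ X.X.fromSpecStalk _ = p.toPartialMap.fromFunctionField) :
    ∑ x ∈ (finite_exDiv p.symm).toFinset with x ∉ Set.range π.ι, (X.closurePt x).cls =
      ∑ x ∈ (finite_exDiv p).toFinset with x ∉ Set.range π.ι, (X.closurePt x).cls := by
  have he' : e.symm.hom ≫ X.X.fromSpecStalk _ ≫ X.str = X.X.fromSpecStalk _ ≫ X.str := by
    rw [Iso.symm_hom, Iso.inv_comp_eq, he]
  have hπ' : e.symm.hom ≫ π.partialMap.fromFunctionField = π.partialMap.fromFunctionField := by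
    rw [Iso.symm_hom, Iso.inv_comp_eq, hπ]
  -- The default value, the generic point, is erased from `T` below: points where `π` is undefined
  -- impose no condition on `V`, being outside `U` in any case. Horizontal points are erased with
  -- them.
  let v : X.X → B.X := fun x => if hx : x ∈ π.partialMap.domain then π.partialMap.hom ⟨x, hx⟩
    else genericPoint B.X
  let T : Finset B.X := (((finite_exDiv p).toFinset ∪ (finite_exDiv p.symm).toFinset).image v).erase
    (genericPoint B.X)
  let V : B.X.Opens := ⟨(⋃ b ∈ T, closure {b})ᶜ,
    (isClosed_biUnion_finset fun _ _ => isClosed_closure).isOpen_compl⟩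
  have hηV : genericPoint B.X ∈ V := by
    intro h
    obtain ⟨b, hb, h⟩ := Set.mem_iUnion₂.mp h
    refine (Finset.mem_erase.mp hb).1 ?_
    exact ((specializes_iff_mem_closure.mpr h).antisymm (genericPoint_specializes b)).eq
  have hTV : ∀ b ∈ T, b ∉ V := fun b hb h =>
    h (Set.mem_iUnion₂.mpr ⟨b, hb, subset_closure rfl⟩)
  let U : X.X.Opens := π.partialMap.domain.ι ''ᵁ π.partialMap.hom ⁻¹ᵁ V
  have hU : ∀ x, x ∈ U ↔ ∃ hx : x ∈ π.partialMap.domain, π.partialMap.hom ⟨x, hx⟩ ∈ V := by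
    refine fun x => ⟨?_, fun ⟨hx, h⟩ => ⟨⟨x, hx⟩, h, rfl⟩⟩
    rintro ⟨z, hz, rfl⟩
    exact ⟨z.2, hz⟩
  have hrange : Set.range π.ι ⊆ U := by
    intro x hx
    obtain ⟨hx, h⟩ := π.mem_range_ι.mp hx
    exact (hU x).mpr ⟨hx, h ▸ hηV⟩
  -- This is the finite set to count in. It may also contain divisors that are not exceptional;
  -- `hex` shows that an exceptional one belongs to it exactly when it is vertical.
  have hfin := finite_codimOne X.X U ((Set.range_nonempty π.ι).mono hrange)
  have hex : ∀ x, Order.coheight x = 1 →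
      x ∈ (finite_exDiv p).toFinset ∪ (finite_exDiv p.symm).toFinset →
      (x ∉ Set.range π.ι ↔ x ∈ hfin.toFinset) := by
    intro x hx1 hx
    rw [Set.Finite.mem_toFinset]
    refine ⟨fun h => ⟨hx1, fun hxU => ?_⟩, fun h hx => h.2 (hrange hx)⟩
    obtain ⟨hxd, hxV⟩ := (hU x).mp hxU
    refine hTV _ (Finset.mem_erase.mpr ⟨fun h' => h (π.mem_range_ι.mpr ⟨hxd, h'⟩), ?_⟩) hxV
    exact Finset.mem_image.mpr ⟨x, hx, dif_pos hxd⟩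
  -- `U` is the preimage of `V` under `π`, and partners have equal values under `π`.
  have hcomp : ∀ x y, LocalIsoAt e x y → y ∈ U → x ∈ U := by
    intro x y h hy
    obtain ⟨hy, hy'⟩ := (hU y).mp hy
    obtain ⟨hx, hx'⟩ := π.partialMap_eq_of_localIsoAt he' hπ' h.symm hy
    exact (hU x).mpr ⟨hx, hx' ▸ hy'⟩
  have hcomp' : ∀ x y, LocalIsoAt e x y → x ∈ U → y ∈ U := by
    intro x y h hx
    obtain ⟨hx, hx'⟩ := (hU x).mp hx
    obtain ⟨hy, hy'⟩ := π.partialMap_eq_of_localIsoAt he hπ h hx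
    exact (hU y).mpr ⟨hy, hy' ▸ hx'⟩
  have key := sum_filter_eq_of_partial_bijection hfin.toFinset (fun x => (X.closurePt x).cls)
    (LocalIsoAt e) (fun x y h => h.cls_closurePt_eq he)
    (fun x y h => by
      rw [Set.Finite.mem_toFinset, Set.Finite.mem_toFinset]
      exact and_congr (by rw [h.coheight_eq]) (not_congr ⟨hcomp' x y h, hcomp x y h⟩))
    (fun _ _ _ h h' => h.unique_right h') (fun _ _ _ h h' => h.unique_left h')
  convert key using 2
  · ext x
    have hmem := mem_exDiv_iff p.symm (germ_symm p e hp) he' (x := x)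
    have hmem' : (∀ y, ¬ LocalIsoAt e.symm x y) ↔ ∀ y, ¬ LocalIsoAt e y x :=
      forall_congr' fun y => not_congr ⟨fun h => h.symm, fun h => h.symm⟩
    rw [hmem'] at hmem
    rw [Finset.mem_filter, Finset.mem_filter]
    constructor
    · rintro ⟨h1, h2⟩
      have h3 := hmem.mp (by simpa using h1)
      exact ⟨(hex x h3.1 (Finset.mem_union_right _ h1)).mp h2, h3.2⟩
    · rintro ⟨h1, h2⟩
      have h3 : x ∈ (finite_exDiv p.symm).toFinset := by
        rw [Set.Finite.mem_toFinset]
        exact hmem.mpr ⟨(hfin.mem_toFinset.mp h1).1, h2⟩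
      exact ⟨h3, (hex x (hfin.mem_toFinset.mp h1).1 (Finset.mem_union_right _ h3)).mpr h1⟩
  · ext x
    have hmem := mem_exDiv_iff p hp he (x := x)
    rw [Finset.mem_filter, Finset.mem_filter]
    constructor
    · rintro ⟨h1, h2⟩
      have h3 := hmem.mp (by simpa using h1)
      exact ⟨(hex x h3.1 (Finset.mem_union_left _ h1)).mp h2, h3.2⟩
    · rintro ⟨h1, h2⟩
      have h3 : x ∈ (finite_exDiv p).toFinset := by
        rw [Set.Finite.mem_toFinset]
        exact hmem.mpr ⟨(hfin.mem_toFinset.mp h1).1, h2⟩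
      exact ⟨h3, (hex x (hfin.mem_toFinset.mp h1).1 (Finset.mem_union_left _ h3)).mpr h1⟩

end DominantMap

end MotivicInv

/-! ### Conclusion -/

theorem mainTheorem8 {k : Type u} [Field k] {X B : MotivicInv.Variety k}
    (π : MotivicInv.DominantMap X B) (φ : MotivicInv.DominantMap.BirOver π) :
    φ.1.cVer = 0 := by
  classical
  open MotivicInv MotivicInv.DominantMap CategoryTheory AlgebraicGeometry in
  obtain ⟨e, hp⟩ := exists_functionFieldIso φ.1.top
  have he : e.hom ≫ X.X.fromSpecStalk _ ≫ X.str = X.X.fromSpecStalk _ ≫ X.str := by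
    rw [reassoc_of% hp]
    exact germ_isOver φ.1.top φ.1.top_isOver
  have he' : e.symm.hom ≫ X.X.fromSpecStalk _ ≫ X.str = X.X.fromSpecStalk _ ≫ X.str := by
    rw [Iso.symm_hom, Iso.inv_comp_eq, he]
  have hπ := π.fromFunctionField_eq_of_base_eq_id φ hp
  have hπ' : e.symm.hom ≫ π.partialMap.fromFunctionField = π.partialMap.fromFunctionField := by
    rw [Iso.symm_hom, Iso.inv_comp_eq, hπ]
  obtain ⟨a, ha, ha'⟩ := π.exists_iso
  have hg := π.exists_generic_germ φ hp ha
  have hg' : (a ≪≫ e.symm ≪≫ a.symm).hom ≫ π.relGenericFibre.V.X.fromSpecStalk (genericPoint _) =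
      φ.1.generic.symm.toPartialMap.fromFunctionField := by
    have h := germ_symm φ.1.generic (a ≪≫ e ≪≫ a.symm) hg
    rwa [show (a ≪≫ e ≪≫ a.symm).symm = a ≪≫ e.symm ≪≫ a.symm by ext1; simp] at h
  have h1 := π.forget_sum_cls φ.1.top φ.1.generic
    (π.mem_exDiv_generic_iff he hπ φ.1.top hp φ.1.generic ha ha' hg)
  have h2 := π.forget_sum_cls φ.1.top.symm φ.1.generic.symm
    (π.mem_exDiv_generic_iff he' hπ' φ.1.top.symm (germ_symm _ e hp) φ.1.generic.symm ha ha' hg')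
  have h3 := π.sum_vertical_eq he hπ φ.1.top hp
  -- Splitting each exceptional sum along the image of the generic fibre, the horizontal parts
  -- cancel against `c_hor` and the vertical parts against each other by `h3`.
  rw [BirMap.cVer, BirMap.cHor, motivicInv, relMotivicInv, map_sub, h1, h2,
    ← Finset.sum_filter_add_sum_filter_not (finite_exDiv φ.1.top).toFinset (· ∈ Set.range π.ι),
    ← Finset.sum_filter_add_sum_filter_not (finite_exDiv φ.1.top.symm).toFinset
      (· ∈ Set.range π.ι), h3]
  abel
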